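/- Throughout, $\mathbb N=\{1,2,\dots\}$, Banach spaces are real, "subspace" means closed infinite-dimensional linear subspace, and $[y_i]$ is the closed linear span of $(y_i)$. **Schreier classes.** For families $\mathcal F,\mathcal G$ of finite subsets of $\mathbb N$ let $\mathcal F[\mathcal G]$ be the family of all unions $G_1\cup\dots\cup G_n$ with nonempty $G_1<\dots<G_n$ in $\mathcal G$ and $\{\min G_1,\dots,\min G_n\}\in\mathcal F$. Put $\mathcal S_0=\{\{n\}:n\in\mathbb N\}\cup\{\emptyset\}$, $\mathcal S_1=\{F:\min F\ge |F|\}\cup\{\emptyset\}$, $\mathcal S_{\alpha+1}=\mathcal S_1[\mathcal S_\alpha]$, and for a countable limit ordinal $\alpha$ let $\mathcal S_\alpha=\{F:\ F\in\mathcal S_{\alpha_n}\text{ and }F\ge n\text{ for some }n\in\mathbb N\}$, where $\alpha_n\uparrow\alpha$ ($\alpha_n<\alpha$) is a fixed sequence; the choices of these sequences are arbitrary. **Blocks.** Let $(x_i)$ be a linearly independent sequence in a Banach space. We write $(y_j)\prec(x_i)$ (finite or infinite sequences) if the $y_j$ are nonzero finite linear combinations of the $x_i$ whose supports satisfy $\operatorname{supp}y_1<\operatorname{supp}y_2<\cdots$.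 A finite $(y_j)_1^k\prec(x_i)$ is $\alpha$-admissible if $\{\min\operatorname{supp}y_j: j\le k\}\in\mathcal S_\alpha$. Let $\delta_\alpha(x_i)$ be the supremum of all $\delta\ge0$ such that $\|\sum_1^k y_j\|\ge\delta\sum_1^k\|y_j\|$ for all $\alpha$-admissible $(y_j)_1^k\prec(x_i)$. **Asymptotic $\ell_1$, $\Delta$-spectrum.** A Banach space $X$ with a Schauder basis $(e_i)$ is asymptotic $\ell_1$ (with respect to $(e_i)$) if there is $C>0$ such that $\|\sum_1^n x_i\|\ge \frac1C\sum_1^n\|x_i\|$ for all $n$ and all finitely supported nonzero $x_1<\dots<x_n$ supported on $\{e_i:i\ge n\}$. A sequence $(x_i)$ $\Delta$-stabilizes $\gamma=(\gamma_\alpha)_{\alpha<\omega_1}\subseteq\mathbb R$ if there are $\varepsilon_n\downarrow0$ such that for every $\alpha<\omega_1$ there is $m$ such that $|\delta_\alpha(y_i)-\gamma_\alpha|<\varepsilon_n$ for all $n\ge m$ and all infinite $(y_i)\prec(x_i)_{i\ge n}$. $\Delta(X)$ is the set of all $\gamma$ that are $\Delta$-stabilized by some $(x_i)\prec(e_i)$.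 **Distortion.** For an equivalent norm $|\cdot|$ on an infinite-dimensional Banach space $(Z,\|\cdot\|)$ let $d(Z,|\cdot|)=\inf_W\sup\{|x|/|y|: x,y\in W,\ \|x\|=\|y\|=1\}$, the infimum being over all subspaces $W$ of $Z$. $Z$ is arbitrarily distortable if for every $\lambda>1$ there is an equivalent norm $|\cdot|$ on $Z$ with $d(Z,|\cdot|)\ge\lambda$. **Statement.** Let $X$ be an asymptotic $\ell_1$ space with respect to a basis $(e_i)$, let $\gamma\in\Delta(X)$ and let $(y_i)\prec(e_i)$ $\Delta$-stabilize $\gamma$. Put $Y=[y_i]$. Suppose that there is $\alpha<\omega_1$ with $\gamma_\alpha>0$ and $$\lim_{n\to\infty}\gamma_{\alpha\cdot n}\,\widehat\gamma_\alpha^{\,-n}=0,\qquad\text{where }\ \widehat\gamma_\alpha=\widehat\gamma_\alpha(Y)=\lim_{k\to\infty}(\gamma_{\alpha\cdot k})^{1/k}.$$ Then $Y$ contains an arbitrarily distortable subspace. -/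

import Mathlib

open Filter Topology
open scoped Ordinal

noncomputable section

namespace DeltaSpectrum

/-! ### Schreier families

The positive integers `1, 2, 3, …` are enumerated here from `0`: the natural number `i` stands for
the positive integer `i + 1`, and `e i` is the `(i + 1)`-st term of a sequence `e`. -/

/-- A choice, for every countable limit ordinal `α`, of a sequence of ordinals `α_n ↑ α` with
`α_n < α`. Values of `c` at other ordinals play no role. -/
def IsLimitChoice (c : Ordinal.{0} → ℕ → Ordinal.{0}) : Prop :=
  ∀ α : Ordinal.{0}, α < ω₁ → Order.IsSuccLimit α →
    Monotone (c α) ∧ (∀ n, c α n < α) ∧ ∀ β < α, ∃ n, β < c α n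

/-- The family `F[G]` of all unions `G_1 ∪ … ∪ G_n` with `G_1 < … < G_n` nonempty members of `G`
such that `{min G_1, …, min G_n}` belongs to `F`. -/
def familyComp (F G : Set (Finset ℕ)) : Set (Finset ℕ) :=
  {A | ∃ (n : ℕ) (E : Fin n → Finset ℕ) (hne : ∀ i, (E i).Nonempty),
    (∀ i, E i ∈ G) ∧
    (∀ i j, i < j → ∀ s ∈ E i, ∀ t ∈ E j, s < t) ∧
    Finset.univ.image (fun i => (E i).min' (hne i)) ∈ F ∧
    A = Finset.univ.biUnion E}

/-- `S_0`: the singletons and the empty set. -/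
def schreierZero : Set (Finset ℕ) := {A | A = ∅ ∨ ∃ i, A = {i}}

/-- `S_1`: the finite sets `A` with `|A| ≤ min A` (and the empty set); the element `i` stands for
the integer `i + 1`. -/
def schreierOne : Set (Finset ℕ) := {A | ∀ i ∈ A, A.card ≤ i + 1}

/-- The Schreier classes `S_α` built from the choice `c` at limit ordinals: `S_{α+1} = S_1[S_α]`,
and for `α` a limit ordinal `S_α` consists of the sets `A` such that for some `n`,
`A ∈ S_{α_n}` and `A ≥ n`. -/
def schreier (c : Ordinal.{0} → ℕ → Ordinal.{0}) (α : Ordinal.{0}) : Set (Finset ℕ) :=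
  Ordinal.limitRecOn (motive := fun _ => Set (Finset ℕ)) α
    schreierZero
    (fun _ S => familyComp schreierOne S)
    (fun β _ S => {A | ∃ (n : ℕ) (h : c β n < β), A ∈ S (c β n) h ∧ ∀ i ∈ A, n ≤ i})

theorem schreier_zero (c : Ordinal.{0} → ℕ → Ordinal.{0}) : schreier c 0 = schreierZero := by
  simp [schreier]

theorem schreier_succ (c : Ordinal.{0} → ℕ → Ordinal.{0}) (α : Ordinal.{0}) :
    schreier c (Order.succ α) = familyComp schreierOne (schreier c α) := by
  simp [schreier]

theorem schreier_limit (c : Ordinal.{0} → ℕ → Ordinal.{0}) (α : Ordinal.{0})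
    (hα : Order.IsSuccLimit α) :
    schreier c α = {A | ∃ n, c α n < α ∧ A ∈ schreier c (c α n) ∧ ∀ i ∈ A, n ≤ i} := by
  ext A
  simp [schreier, Ordinal.limitRecOn_limit _ _ _ _ hα, and_assoc]

/-! ### Blocks -/

/-- A family of coefficient vectors with nonempty, finite and successive supports. -/
def IsSuccessive {ι : Type*} [LT ι] (a : ι → ℕ →₀ ℝ) : Prop :=
  (∀ i, a i ≠ 0) ∧ ∀ i j, i < j → ∀ s ∈ (a i).support, ∀ t ∈ (a j).support, s < t

/-- `min supp a`, for `a ≠ 0`. -/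
def minSupp (a : ℕ →₀ ℝ) : ℕ := sInf (a.support : Set ℕ)

/-- `(a_1, …, a_k)` is `F`-admissible: `{min supp a_1, …, min supp a_k} ∈ F`. -/
def IsAdmissible (F : Set (Finset ℕ)) {k : ℕ} (a : Fin k → ℕ →₀ ℝ) : Prop :=
  Finset.univ.image (fun i => minSupp (a i)) ∈ F

variable {E : Type*} [NormedAddCommGroup E] [NormedSpace ℝ E]

/-- The vector `∑ i, a_i x_i` of the linear span of the sequence `x`. -/
def comb (x : ℕ → E) (a : ℕ →₀ ℝ) : E := Finsupp.linearCombination ℝ x a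

/-- `y ≺ x`: the sequence `y` is a block basis of the sequence `x`. -/
def IsBlockBasis (y x : ℕ → E) : Prop :=
  ∃ a : ℕ → ℕ →₀ ℝ, IsSuccessive a ∧ ∀ j, y j = comb x (a j)

/-- The space with the Schauder basis `e` is asymptotic `ℓ₁` with respect to `e`: for some `C`,
`‖x_1 + … + x_n‖ ≥ (1/C) (‖x_1‖ + … + ‖x_n‖)` for all `n` and all `e_n ≤ x_1 < … < x_n`. -/
def IsAsymptoticL1 (e : SchauderBasis ℝ E) : Prop :=
  ∃ C : ℝ, 0 < C ∧ ∀ (n : ℕ) (a : Fin n → ℕ →₀ ℝ), IsSuccessive a →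
    (∀ j, ∀ i ∈ (a j).support, n ≤ i + 1) →
    (1 / C) * ∑ j, ‖comb e (a j)‖ ≤ ‖∑ j, comb e (a j)‖

/-- `δ_F(x)`: the supremum of the `δ ≥ 0` such that `‖∑ y_i‖ ≥ δ ∑ ‖y_i‖` for every finite block
sequence `(y_i)` of `x` that is `F`-admissible with respect to `x`. -/
def deltaConst (F : Set (Finset ℕ)) (x : ℕ → E) : ℝ :=
  sSup {δ : ℝ | 0 ≤ δ ∧ ∀ (k : ℕ) (a : Fin k → ℕ →₀ ℝ), IsSuccessive a → IsAdmissible F a →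
    δ * ∑ i, ‖comb x (a i)‖ ≤ ‖∑ i, comb x (a i)‖}

/-- The sequence `x` `Δ`-stabilizes `γ = (γ_α)_{α < ω₁}`; values of `γ` at `α ≥ ω₁` play no
role. -/
def DeltaStabilizes (c : Ordinal.{0} → ℕ → Ordinal.{0}) (x : ℕ → E)
    (γ : Ordinal.{0} → ℝ) : Prop :=
  ∃ ε : ℕ → ℝ, Antitone ε ∧ Tendsto ε atTop (𝓝 0) ∧
    ∀ α : Ordinal.{0}, α < ω₁ → ∃ m : ℕ, ∀ n ≥ m, ∀ y : ℕ → E,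
      IsBlockBasis y (fun i => x (n + i)) → |deltaConst (schreier c α) y - γ α| < ε n

/-- The `Δ`-spectrum of the space with basis `e`. -/
def deltaSpectrum (c : Ordinal.{0} → ℕ → Ordinal.{0}) (e : SchauderBasis ℝ E) :
    Set (Ordinal.{0} → ℝ) :=
  {γ | ∃ x : ℕ → E, IsBlockBasis x e ∧ DeltaStabilizes c x γ}

/-- `γ̂_α = lim_n (γ_{α·n})^{1/n}`. -/
def gammaHat (γ : Ordinal.{0} → ℝ) (α : Ordinal.{0}) : ℝ :=
  limUnder atTop (fun n : ℕ => γ (α * (n : Ordinal.{0})) ^ (1 / (n : ℝ)))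

/-- The closed linear span `[y_i]`. -/
def closedSpan (y : ℕ → E) : Submodule ℝ E :=
  (Submodule.span ℝ (Set.range y)).topologicalClosure

/-! ### Distortion -/

variable (E) in
/-- The infinite-dimensional closed linear subspaces of `E`. -/
def InfSubspace : Type _ :=
  {Y : Submodule ℝ E // IsClosed (Y : Set E) ∧ ¬ FiniteDimensional ℝ Y}

/-- `p` is a norm on `E` equivalent to the given one. -/
def IsEquivalentNorm (p : Seminorm ℝ E) : Prop :=
  ∃ a b : ℝ, 0 < a ∧ ∀ x : E, a * ‖x‖ ≤ p x ∧ p x ≤ b * ‖x‖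

/-- The distortion `d(E, p) = inf_Y sup {p x / p y : x, y ∈ Y, ‖x‖ = ‖y‖ = 1}` of an equivalent
norm `p`, where `Y` runs over the infinite-dimensional closed subspaces of `E`. -/
def distortion (p : Seminorm ℝ E) : ℝ :=
  ⨅ Y : InfSubspace E,
    sSup {r : ℝ | ∃ x ∈ Y.1, ∃ y ∈ Y.1, ‖x‖ = 1 ∧ ‖y‖ = 1 ∧ r = p x / p y}

variable (E) in
/-- `E` is `l`-distortable. -/
def IsDistortable (l : ℝ) : Prop :=
  ∃ p : Seminorm ℝ E, IsEquivalentNorm p ∧ l ≤ distortion p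

variable (E) in
/-- `E` is arbitrarily distortable. -/
def IsArbitrarilyDistortable : Prop := ∀ l : ℝ, 1 < l → IsDistortable E l

end DeltaSpectrum

end

open DeltaSpectrum

noncomputable section

open scoped NNReal

namespace DeltaSpectrum

/-! ### Combinatorics of Schreier families -/

/-! The whole span `Y = [y_i]` is arbitrarily distortable. Let `b` be the basis `(y_i)` of `Y`, with
interval projections bounded by `B`, and let `θ = γ̂_α > 0`. Given `l`, choose `n` with `γ_{α·n} <
θ^n / (12 l)`, and put `β = α·n`, `t = θ^n / 2`. The aim is an equivalent norm `p` with a lower `ℓ₁`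
constant `t` on (sparse) `S_β`-admissible blocks, whereas the original norm has constant about
`γ_β`, much smaller than `t`, on every block basis.

Construction of `p`. Let `f_i(x)` be the supremum of `∑ ‖P_I x‖` over successive intervals `I` whose
left ends form a set in `S_{β·i}`. On a far tail of the basis `f_0 ≥ ‖·‖`, and the lower estimate
`δ_{β·N}` of the tail gives `f_N ≤ (B² / δ_{β·N}) ‖·‖`. Joining near-optimal interval families of
the blocks `v_j` gives `∑ f_i(v_j) ≤ f_{i+1}(∑ v_j)`, provided that `S_β[S_{β·i}]` lies in
`S_{β·(i+1)}`. For `p = ∑_{i<N} t^i f_i` the sum `t ∑ p(v_j)` is then at most `p(x) - f_0(x) + t^N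
f_N(x)`, where `x = ∑ v_j`. The last two terms together are nonpositive once `t^N B² ≤ δ_{β·N}`.
Such an `N` exists because `(γ_{β·N})^{1/N}` tends to `θ^n = 2t`; this is where the definition of
`θ` as a root limit enters.

Oscillation. Any infinite-dimensional `W` contains small perturbations of a block basis `w` of the
tail. Stabilization gives `δ_β(w) < 2 γ_β`, hence admissible blocks `d_i` of `w` with `‖∑ d_i‖ < 2
γ_β ∑ ‖d_i‖`, while `p(∑ d_i) ≥ t ∑ p(d_i)`. By averaging, the ratio `p / ‖·‖` at `∑ d_i` exceeds
its value at some `d_i` by a factor about `t / (2 γ_β)`. After perturbation losses the distortion is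
at least `t / (6 γ_β) > l`.

Since the sequences defining `S_α` at limits are arbitrary, `S_α[S_β]` and `S_{β+α}` are comparable
only after thinning out. `exists_image_mem_familyComp` gives one direction, hence `γ_α γ_β ≤
γ_{β+α}` and the existence of `θ`; `exists_familyComp_sparseFamily_subset` gives the other, used for
`p`. The analytic core is `exists_seminorm_of_chain` and `le_of_oscillation_le`. -/

/-- A family of finite sets which is hereditary and closed under moving elements to the right. -/
def IsSpreading (F : Set (Finset ℕ)) : Prop :=
  ∀ A ∈ F, ∀ (B : Finset ℕ) (g : ℕ → ℕ), StrictMonoOn g B → (∀ b ∈ B, g b ∈ A) →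
    (∀ b ∈ B, g b ≤ b) → B ∈ F

theorem IsSpreading.subset {F : Set (Finset ℕ)} (hF : IsSpreading F) {A B : Finset ℕ}
    (hA : A ∈ F) (h : B ⊆ A) : B ∈ F :=
  hF A hA B id (strictMono_id.strictMonoOn _) (fun _ hb => h hb) fun _ _ => le_rfl

theorem IsSpreading.image {ι : Type*} [LinearOrder ι] [Nonempty ι] {F : Set (Finset ℕ)}
    (hF : IsSpreading F) {A : Finset ι} {f h : ι → ℕ} (hf : StrictMonoOn f A)
    (hh : StrictMonoOn h A) (hle : ∀ a ∈ A, f a ≤ h a) (hA : A.image f ∈ F) :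
    A.image h ∈ F := by
  have inv : ∀ a ∈ A, Function.invFunOn h (A : Set ι) (h a) = a := fun a ha =>
    hh.injOn.leftInvOn_invFunOn ha
  refine hF _ hA _ (fun m => f (Function.invFunOn h (A : Set ι) m)) ?_ ?_ ?_
  · intro x hx y hy hxy
    simp only [Finset.coe_image, Set.mem_image, Finset.mem_coe] at hx hy
    obtain ⟨a, ha, rfl⟩ := hx
    obtain ⟨b, hb, rfl⟩ := hy
    simp only [inv a ha, inv b hb]
    exact hf ha hb ((hh.lt_iff_lt ha hb).1 hxy)
  · intro x hx
    obtain ⟨a, ha, rfl⟩ := Finset.mem_image.1 hx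
    simp only [inv a ha]
    exact Finset.mem_image_of_mem _ ha
  · intro x hx
    obtain ⟨a, ha, rfl⟩ := Finset.mem_image.1 hx
    simp only [inv a ha]
    exact hle a ha

/-- Colouring each element by the minimum of its piece encodes the decomposition as one map `φ` on
`ℕ`; the pieces are its fibres. All later manipulations of `F[G]` are done on such colourings. -/
theorem exists_coloring_of_mem_familyComp {F G : Set (Finset ℕ)} {A : Finset ℕ}
    (h : A ∈ familyComp F G) :
    ∃ φ : ℕ → ℕ, MonotoneOn φ A ∧ (∀ a ∈ A, φ a ≤ a) ∧ (∀ a ∈ A, φ a ∈ A) ∧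
      (∀ a ∈ A, φ (φ a) = φ a) ∧ A.image φ ∈ F ∧
      ∀ k ∈ A.image φ, A.filter (fun a => φ a = k) ∈ G := by
  classical
  obtain ⟨n, E, hne, hG, hlt, hF, rfl⟩ := h
  have hmem : ∀ i, (E i).min' (hne i) ∈ E i := fun i => Finset.min'_mem _ _
  have huniq : ∀ i j a, a ∈ E i → a ∈ E j → i = j := by
    intro i j a hi hj
    rcases lt_trichotomy i j with hij | hij | hij
    · exact absurd (hlt i j hij a hi a hj) (lt_irrefl _)
    · exact hij
    · exact absurd (hlt j i hij a hj a hi) (lt_irrefl _)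
  let φ : ℕ → ℕ := fun a => if h : ∃ i, a ∈ E i then (E h.choose).min' (hne _) else 0
  have hφ : ∀ i, ∀ a ∈ E i, φ a = (E i).min' (hne i) := by
    intro i a ha
    have hex : ∃ i, a ∈ E i := ⟨i, ha⟩
    have : hex.choose = i := huniq _ _ a hex.choose_spec ha
    simp only [φ, dif_pos hex]
    congr 1
    rw [this]
  have himg : (Finset.univ.biUnion E).image φ =
      Finset.univ.image (fun i => (E i).min' (hne i)) := by
    ext k
    simp only [Finset.mem_image, Finset.mem_biUnion, Finset.mem_univ, true_and]
    constructor
    · rintro ⟨a, ⟨i, hi⟩, rfl⟩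
      exact ⟨i, (hφ i a hi).symm⟩
    · rintro ⟨i, rfl⟩
      exact ⟨_, ⟨i, hmem i⟩, hφ i _ (hmem i)⟩
  refine ⟨φ, ?_, ?_, ?_, ?_, himg ▸ hF, ?_⟩
  · intro a ha b hb hab
    simp only [Finset.coe_biUnion, Finset.coe_univ, Set.mem_univ, Set.iUnion_true,
      Set.mem_iUnion, Finset.mem_coe] at ha hb
    obtain ⟨i, hi⟩ := ha
    obtain ⟨j, hj⟩ := hb
    rw [hφ i a hi, hφ j b hj]
    rcases lt_trichotomy i j with hij | hij | hij
    · exact (hlt i j hij _ (hmem i) _ (hmem j)).le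
    · subst hij; exact le_rfl
    · exact absurd (hlt j i hij _ hj _ hi) (not_lt.2 hab)
  · intro a ha
    simp only [Finset.mem_biUnion, Finset.mem_univ, true_and] at ha
    obtain ⟨i, hi⟩ := ha
    rw [hφ i a hi]
    exact Finset.min'_le _ _ hi
  · intro a ha
    simp only [Finset.mem_biUnion, Finset.mem_univ, true_and] at ha ⊢
    obtain ⟨i, hi⟩ := ha
    rw [hφ i a hi]
    exact ⟨i, hmem i⟩
  · intro a ha
    simp only [Finset.mem_biUnion, Finset.mem_univ, true_and] at ha
    obtain ⟨i, hi⟩ := ha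
    rw [hφ i a hi]
    exact hφ i _ (hmem i)
  · intro k hk
    rw [himg] at hk
    simp only [Finset.mem_image, Finset.mem_univ, true_and] at hk
    obtain ⟨i, rfl⟩ := hk
    convert hG i using 1
    ext a
    simp only [Finset.mem_filter, Finset.mem_biUnion, Finset.mem_univ, true_and]
    constructor
    · rintro ⟨⟨j, hj⟩, h⟩
      rw [hφ j a hj] at h
      have : j = i := huniq j i _ (hmem j) (h ▸ hmem i)
      exact this ▸ hj
    · intro ha
      exact ⟨⟨i, ha⟩, hφ i a ha⟩

/-- The colour of a piece need not be its minimum, only a lower bound: spreading of `F` moves the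
set of colours right to the set of minima. -/
theorem mem_familyComp_of_coloring {F G : Set (Finset ℕ)} (hF : IsSpreading F)
    {A : Finset ℕ} (φ : ℕ → ℕ) (hmono : MonotoneOn φ A) (hle : ∀ a ∈ A, φ a ≤ a)
    (himg : A.image φ ∈ F) (hG : ∀ k ∈ A.image φ, A.filter (fun a => φ a = k) ∈ G) :
    A ∈ familyComp F G := by
  classical
  set L := A.image φ with hL
  let o := L.orderEmbOfFin (rfl : L.card = L.card)
  have ho : ∀ i, o i ∈ L := fun i => Finset.orderEmbOfFin_mem _ _ i
  have hsurj : ∀ l ∈ L, ∃ i, o i = l := by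
    intro l hl
    have : l ∈ Set.range o := by rw [Finset.range_orderEmbOfFin]; exact hl
    exact this
  have hne : ∀ i, (A.filter (fun a => φ a = o i)).Nonempty := by
    intro i
    obtain ⟨a, ha, h⟩ := Finset.mem_image.1 (ho i)
    exact ⟨a, Finset.mem_filter.2 ⟨ha, h⟩⟩
  have hmin : ∀ i, (A.filter (fun a => φ a = o i)).min' (hne i) ∈ A ∧
      φ ((A.filter (fun a => φ a = o i)).min' (hne i)) = o i := fun i =>
    Finset.mem_filter.1 (Finset.min'_mem _ (hne i))
  have hlt : ∀ i j, i < j → ∀ s ∈ A.filter (fun a => φ a = o i),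
      ∀ t ∈ A.filter (fun a => φ a = o j), s < t := by
    intro i j hij s hs t ht
    rw [Finset.mem_filter] at hs ht
    by_contra hcon
    have := hmono ht.1 hs.1 (not_lt.1 hcon)
    rw [hs.2, ht.2] at this
    exact absurd (o.strictMono hij) (not_lt.2 this)
  refine ⟨L.card, fun i => A.filter (fun a => φ a = o i), hne, fun i => hG _ (ho i), hlt, ?_, ?_⟩
  · rcases isEmpty_or_nonempty (Fin L.card) with hemp | hnon
    · rw [Finset.univ_eq_empty, Finset.image_empty]
      exact hF.subset himg (Finset.empty_subset _)
    · refine hF.image (A := (Finset.univ : Finset (Fin L.card))) (f := o)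
        (fun i _ j _ hij => o.strictMono hij) ?_ ?_ ?_
      · intro i _ j _ hij
        exact hlt i j hij _ (Finset.min'_mem _ _) _ (Finset.min'_mem _ _)
      · intro i _
        conv_lhs => rw [← (hmin i).2]
        exact hle _ (hmin i).1
      · convert himg using 1
        ext l
        simp only [Finset.mem_image, Finset.mem_univ, true_and]
        constructor
        · rintro ⟨i, rfl⟩; exact ho i
        · exact hsurj l
  · ext a
    simp only [Finset.mem_biUnion, Finset.mem_univ, true_and, Finset.mem_filter]
    constructor
    · intro ha
      obtain ⟨i, hi⟩ := hsurj (φ a) (Finset.mem_image_of_mem _ ha)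
      exact ⟨i, ha, hi.symm⟩
    · rintro ⟨_, ha, _⟩; exact ha

theorem familyComp_mono {F F' G G' : Set (Finset ℕ)} (hF : F ⊆ F') (hG : G ⊆ G') :
    familyComp F G ⊆ familyComp F' G' := by
  rintro A ⟨n, E, hne, h1, h2, h3, h4⟩
  exact ⟨n, E, hne, fun i => hG (h1 i), h2, hF h3, h4⟩

theorem IsSpreading.familyComp {F G : Set (Finset ℕ)} (hF : IsSpreading F)
    (hG : IsSpreading G) : IsSpreading (familyComp F G) := by
  classical
  intro A hA B g hg hgA hgle
  obtain ⟨φ, h1, h2, -, -, h3, h4⟩ := exists_coloring_of_mem_familyComp hA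
  refine mem_familyComp_of_coloring hF (fun b => φ (g b)) ?_ ?_ ?_ ?_
  · intro a ha b hb hab
    exact h1 (hgA a ha) (hgA b hb) (hg.monotoneOn ha hb hab)
  · intro b hb
    exact (h2 _ (hgA b hb)).trans (hgle b hb)
  · refine hF.subset h3 ?_
    intro k hk
    obtain ⟨b, hb, rfl⟩ := Finset.mem_image.1 hk
    exact Finset.mem_image_of_mem _ (hgA b hb)
  · intro k hk
    obtain ⟨b, hb, rfl⟩ := Finset.mem_image.1 hk
    refine hG _ (h4 _ (Finset.mem_image_of_mem φ (hgA b hb))) _ g ?_ ?_ ?_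
    · exact hg.mono fun x hx => (Finset.mem_filter.1 hx).1
    · intro x hx
      rw [Finset.mem_filter] at hx ⊢
      exact ⟨hgA x hx.1, hx.2⟩
    · intro x hx
      exact hgle x (Finset.mem_filter.1 hx).1

theorem familyComp_assoc_subset {F₁ F₂ G : Set (Finset ℕ)} (h₁ : IsSpreading F₁)
    (h₂ : IsSpreading F₂) :
    familyComp F₁ (familyComp F₂ G) ⊆ familyComp (familyComp F₁ F₂) G := by
  classical
  intro A hA
  obtain ⟨φ, hφ1, hφ2, -, -, hφ3, hφ4⟩ := exists_coloring_of_mem_familyComp hA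
  have hex : ∀ k, ∃ ψ : ℕ → ℕ, k ∈ A.image φ →
      MonotoneOn ψ (A.filter (fun a => φ a = k)) ∧ (∀ a ∈ A.filter (fun a => φ a = k), ψ a ≤ a) ∧
      (∀ a ∈ A.filter (fun a => φ a = k), ψ a ∈ A.filter (fun a => φ a = k)) ∧
      (A.filter (fun a => φ a = k)).image ψ ∈ F₂ ∧
      ∀ l ∈ (A.filter (fun a => φ a = k)).image ψ,
        (A.filter (fun a => φ a = k)).filter (fun a => ψ a = l) ∈ G := by
    intro k
    by_cases hk : k ∈ A.image φ
    · obtain ⟨ψ, h1, h2, h3, -, h5, h6⟩ := exists_coloring_of_mem_familyComp (hφ4 k hk)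
      exact ⟨ψ, fun _ => ⟨h1, h2, h3, h5, h6⟩⟩
    · exact ⟨id, fun h => absurd h hk⟩
  choose ψ hψ using hex
  have him : ∀ a ∈ A, φ a ∈ A.image φ := fun a ha => Finset.mem_image_of_mem _ ha
  have hfil : ∀ a ∈ A, a ∈ A.filter (fun x => φ x = φ a) := fun a ha =>
    Finset.mem_filter.2 ⟨ha, rfl⟩
  -- The fine colouring: inside each coarse piece, the colour given by that piece's own
  -- decomposition. It stays in the same coarse piece, so `φ ∘ χ = φ` on `A`.
  let χ : ℕ → ℕ := fun a => ψ (φ a) a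
  have hχmem : ∀ a ∈ A, χ a ∈ A ∧ φ (χ a) = φ a := fun a ha =>
    Finset.mem_filter.1 ((hψ _ (him a ha)).2.2.1 a (hfil a ha))
  refine mem_familyComp_of_coloring (h₁.familyComp h₂) χ ?_ ?_ ?_ ?_
  · intro a ha b hb hab
    rcases (hφ1 ha hb hab).lt_or_eq with h | h
    · by_contra hcon
      have := hφ1 (hχmem b hb).1 (hχmem a ha).1 (not_le.1 hcon).le
      rw [(hχmem a ha).2, (hχmem b hb).2] at this
      exact absurd h (not_lt.2 this)
    · have h1 := (hψ _ (him a ha)).1 (Finset.mem_coe.2 (hfil a ha))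
        (Finset.mem_coe.2 (Finset.mem_filter.2 ⟨hb, h.symm⟩)) hab
      simpa only [χ, ← h] using h1
  · intro a ha
    exact (hψ _ (him a ha)).2.1 a (hfil a ha)
  · refine mem_familyComp_of_coloring h₁ φ ?_ ?_ ?_ ?_
    · refine hφ1.mono ?_
      intro x hx
      obtain ⟨a, ha, rfl⟩ := Finset.mem_image.1 hx
      exact (hχmem a ha).1
    · intro x hx
      obtain ⟨a, ha, rfl⟩ := Finset.mem_image.1 hx
      exact hφ2 _ (hχmem a ha).1
    · refine h₁.subset hφ3 ?_
      intro k hk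
      obtain ⟨x, hx, rfl⟩ := Finset.mem_image.1 hk
      obtain ⟨a, ha, rfl⟩ := Finset.mem_image.1 hx
      exact him _ (hχmem a ha).1
    · intro k hk
      obtain ⟨x, hx, rfl⟩ := Finset.mem_image.1 hk
      obtain ⟨a, ha, rfl⟩ := Finset.mem_image.1 hx
      rw [(hχmem a ha).2]
      refine h₂.subset (hψ _ (him a ha)).2.2.2.1 ?_
      intro y hy
      rw [Finset.mem_filter] at hy
      obtain ⟨b, hb, rfl⟩ := Finset.mem_image.1 hy.1
      have hba : φ b = φ a := (hχmem b hb).2.symm.trans hy.2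
      refine Finset.mem_image.2 ⟨b, Finset.mem_filter.2 ⟨hb, hba⟩, ?_⟩
      simp only [χ, hba]
  · intro l hl
    obtain ⟨a, ha, rfl⟩ := Finset.mem_image.1 hl
    have := (hψ _ (him a ha)).2.2.2.2 (χ a) (Finset.mem_image_of_mem _ (hfil a ha))
    convert this using 1
    ext b
    simp only [Finset.mem_filter]
    constructor
    · rintro ⟨hb, h⟩
      have hba : φ b = φ a := by rw [← (hχmem b hb).2, h, (hχmem a ha).2]
      refine ⟨⟨hb, hba⟩, ?_⟩
      simpa only [χ, hba] using h
    · rintro ⟨⟨hb, hba⟩, h⟩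
      refine ⟨hb, ?_⟩
      simpa only [χ, hba] using h

theorem familyComp_assoc_superset {F₁ F₂ G : Set (Finset ℕ)} (h₁ : IsSpreading F₁)
    (h₂ : IsSpreading F₂) (hG : IsSpreading G) :
    familyComp (familyComp F₁ F₂) G ⊆ familyComp F₁ (familyComp F₂ G) := by
  classical
  intro A hA
  obtain ⟨ψ, hψ1, hψ2, -, -, hψ3, hψ4⟩ := exists_coloring_of_mem_familyComp hA
  obtain ⟨φ, hφ1, hφ2, -, -, hφ3, hφ4⟩ := exists_coloring_of_mem_familyComp hψ3
  have him : ∀ a ∈ A, ψ a ∈ A.image ψ := fun a ha => Finset.mem_image_of_mem _ ha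
  refine mem_familyComp_of_coloring h₁ (fun a => φ (ψ a)) ?_ ?_ ?_ ?_
  · intro a ha b hb hab
    exact hφ1 (him a ha) (him b hb) (hψ1 ha hb hab)
  · intro a ha
    exact (hφ2 _ (him a ha)).trans (hψ2 a ha)
  · rw [Finset.image_image] at hφ3
    exact hφ3
  · intro k hk
    obtain ⟨a, ha, rfl⟩ := Finset.mem_image.1 hk
    refine mem_familyComp_of_coloring h₂ ψ ?_ ?_ ?_ ?_
    · exact hψ1.mono fun x hx => (Finset.mem_filter.1 hx).1
    · intro x hx
      exact hψ2 x (Finset.mem_filter.1 hx).1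
    · refine h₂.subset (hφ4 _ (Finset.mem_image_of_mem φ (him a ha))) ?_
      intro y hy
      obtain ⟨b, hb, rfl⟩ := Finset.mem_image.1 hy
      rw [Finset.mem_filter] at hb ⊢
      exact ⟨him b hb.1, hb.2⟩
    · intro l hl
      obtain ⟨b, hb, rfl⟩ := Finset.mem_image.1 hl
      refine hG.subset (hψ4 _ (him b (Finset.mem_filter.1 hb).1)) ?_
      intro x hx
      rw [Finset.mem_filter, Finset.mem_filter] at hx
      exact Finset.mem_filter.2 ⟨hx.1.1, hx.2⟩

theorem isSpreading_schreierZero : IsSpreading schreierZero := by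
  intro A hA B g hg hgA _
  have hA' : A.card ≤ 1 := by
    rcases hA with rfl | ⟨i, rfl⟩ <;> simp
  have hB : B.card ≤ 1 :=
    (Finset.card_le_card_of_injOn g (fun b hb => hgA b hb) hg.injOn).trans hA'
  rcases B.eq_empty_or_nonempty with h | h
  · exact Or.inl h
  · exact Or.inr (Finset.card_eq_one.1 (le_antisymm hB h.card_pos))

theorem isSpreading_schreierOne : IsSpreading schreierOne := by
  intro A hA B g hg hgA hgle b hb
  have hB : B.card ≤ A.card := Finset.card_le_card_of_injOn g (fun b hb => hgA b hb) hg.injOn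
  have := hA _ (hgA b hb)
  have := hgle b hb
  omega

theorem isSpreading_schreier (c : Ordinal.{0} → ℕ → Ordinal.{0}) (α : Ordinal.{0}) :
    IsSpreading (schreier c α) := by
  induction α using Ordinal.limitRecOn with
  | zero => rw [schreier_zero]; exact isSpreading_schreierZero
  | add_one α ih =>
    rw [← Order.succ_eq_add_one, schreier_succ]
    exact isSpreading_schreierOne.familyComp ih
  | limit α hα ih =>
    rw [schreier_limit c α hα]
    rintro A ⟨n, hn, hA, hnA⟩ B g hg hgA hgle
    exact ⟨n, hn, ih _ hn A hA B g hg hgA hgle,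
      fun b hb => (hnA _ (hgA b hb)).trans (hgle b hb)⟩

theorem schreier_subset_succ (c : Ordinal.{0} → ℕ → Ordinal.{0}) (α : Ordinal.{0}) :
    schreier c α ⊆ schreier c (Order.succ α) := by
  intro A hA
  rw [schreier_succ]
  -- The whole set is one piece; the colour `0`, which stands for the integer 1, is a lower bound of
  -- anything and `{0}` has an admissible cardinality.
  refine mem_familyComp_of_coloring isSpreading_schreierOne (fun _ => 0) ?_ ?_ ?_ ?_
  · intro a _ b _ _; exact le_rfl
  · intro a _; exact Nat.zero_le _
  · intro i _
    exact (Finset.card_le_one.2 (by simp)).trans (by omega)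
  · intro k _
    exact (isSpreading_schreier c α).subset hA (Finset.filter_subset _ _)

theorem singleton_mem_schreier {c : Ordinal.{0} → ℕ → Ordinal.{0}} (hc : IsLimitChoice c)
    {α : Ordinal.{0}} (hα : α < ω₁) (i : ℕ) : {i} ∈ schreier c α := by
  induction α using Ordinal.limitRecOn with
  | zero => rw [schreier_zero]; exact Or.inr ⟨i, rfl⟩
  | add_one α ih =>
    rw [← Order.succ_eq_add_one] at hα ⊢
    exact schreier_subset_succ c α (ih ((Order.lt_succ α).trans hα))
  | limit α hl ih =>
    rw [schreier_limit c α hl]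
    have h0 := (hc α hα hl).2.1 0
    exact ⟨0, h0, ih _ h0 (h0.trans hα), fun i _ => Nat.zero_le i⟩

theorem empty_mem_schreier {c : Ordinal.{0} → ℕ → Ordinal.{0}} (hc : IsLimitChoice c)
    {α : Ordinal.{0}} (hα : α < ω₁) : ∅ ∈ schreier c α :=
  (isSpreading_schreier c α).subset (singleton_mem_schreier hc hα 0) (Finset.empty_subset _)

/-- Arbitrary sequences at limits destroy monotonicity of the classes, but only near the origin: at
a limit one enters some `S_{β_n}` with `β_n > α`, at the price of discarding finitely many integers.
-/
theorem schreier_eventually_subset {c : Ordinal.{0} → ℕ → Ordinal.{0}} (hc : IsLimitChoice c)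
    {α β : Ordinal.{0}} (hβ : β < ω₁) (h : α ≤ β) :
    ∃ k : ℕ, ∀ A ∈ schreier c α, (∀ a ∈ A, k ≤ a) → A ∈ schreier c β := by
  induction β using Ordinal.limitRecOn with
  | zero =>
    have : α = 0 := le_antisymm h (by simp)
    exact ⟨0, fun A hA _ => this ▸ hA⟩
  | add_one β ih =>
    rw [← Order.succ_eq_add_one] at *
    rcases h.lt_or_eq with h | rfl
    · obtain ⟨k, hk⟩ := ih ((Order.lt_succ β).trans hβ) (Order.lt_succ_iff.1 h)
      exact ⟨k, fun A hA hkA => schreier_subset_succ c β (hk A hA hkA)⟩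
    · exact ⟨0, fun A hA _ => hA⟩
  | limit β hl ih =>
    rcases h.lt_or_eq with h | rfl
    · obtain ⟨n, hn⟩ := (hc β hβ hl).2.2 α h
      have hlt := (hc β hβ hl).2.1 n
      obtain ⟨k, hk⟩ := ih _ hlt (hlt.trans hβ) hn.le
      refine ⟨max k n, fun A hA hkA => ?_⟩
      rw [schreier_limit c β hl]
      exact ⟨n, hlt, hk A hA fun a ha => (le_max_left _ _).trans (hkA a ha),
        fun a ha => (le_max_right _ _).trans (hkA a ha)⟩
    · exact ⟨0, fun A hA _ => hA⟩

/-! ### Comparison of `S_α[S_β]` with `S_{β+α}` -/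

theorem ordinal_add_succ (α β : Ordinal.{0}) : α + Order.succ β = Order.succ (α + β) := by
  simp only [Order.succ_eq_add_one, add_assoc]

theorem exists_strictMono_ge (h : ℕ → ℕ) : ∃ M : ℕ → ℕ, StrictMono M ∧ ∀ i, h i ≤ M i := by
  refine ⟨fun i => ∑ j ∈ Finset.range (i + 1), (h j + 1), ?_, ?_⟩
  · refine strictMono_nat_of_lt_succ fun i => ?_
    simp only [Finset.sum_range_succ _ (i + 1)]
    omega
  · intro i
    simp only [Finset.sum_range_succ _ i]
    omega

/-- Induction on `α`. Successors follow from associativity of the bracket. At a limit, the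
approximating sequences of `β + α` and of `α` are unrelated, and a diagonal choice of `M` reconciles
them. -/
theorem exists_image_mem_familyComp {c : Ordinal.{0} → ℕ → Ordinal.{0}} (hc : IsLimitChoice c)
    {α β : Ordinal.{0}} (h : β + α < ω₁) :
    ∃ M : ℕ → ℕ, StrictMono M ∧ ∀ A ∈ schreier c (β + α),
      A.image M ∈ familyComp (schreier c α) (schreier c β) := by
  classical
  induction α using Ordinal.limitRecOn with
  | zero =>
    refine ⟨id, strictMono_id, fun A hA => ?_⟩
    rw [add_zero] at hA
    rw [Finset.image_id]
    refine mem_familyComp_of_coloring (isSpreading_schreier c 0) (fun _ => 0) ?_ ?_ ?_ ?_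
    · intro a _ b _ _; exact le_rfl
    · intro a _; exact Nat.zero_le _
    · rw [schreier_zero]
      refine isSpreading_schreierZero.subset (A := {0}) (Or.inr ⟨0, rfl⟩) ?_
      intro x hx
      obtain ⟨_, _, rfl⟩ := Finset.mem_image.1 hx
      simp
    · intro k _
      exact (isSpreading_schreier c β).subset hA (Finset.filter_subset _ _)
  | add_one α ih =>
    rw [← Order.succ_eq_add_one] at *
    rw [ordinal_add_succ] at h
    obtain ⟨M, hM, hA⟩ := ih ((Order.lt_succ _).trans h)
    refine ⟨M, hM, fun A hA' => ?_⟩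
    rw [ordinal_add_succ, schreier_succ] at hA'
    rw [schreier_succ]
    refine familyComp_assoc_subset isSpreading_schreierOne (isSpreading_schreier c α) ?_
    obtain ⟨φ, h1, h2, h3, -, h4, h5⟩ := exists_coloring_of_mem_familyComp hA'
    have hinv : ∀ a, Function.invFun M (M a) = a := Function.leftInverse_invFun hM.injective
    refine mem_familyComp_of_coloring isSpreading_schreierOne
      (fun m => M (φ (Function.invFun M m))) ?_ ?_ ?_ ?_
    · intro x hx y hy hxy
      obtain ⟨a, ha, rfl⟩ := Finset.mem_image.1 hx
      obtain ⟨b, hb, rfl⟩ := Finset.mem_image.1 hy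
      simp only [hinv]
      exact hM.monotone (h1 ha hb (hM.le_iff_le.1 hxy))
    · intro x hx
      obtain ⟨a, ha, rfl⟩ := Finset.mem_image.1 hx
      simp only [hinv]
      exact hM.monotone (h2 a ha)
    · have : (A.image M).image (fun m => M (φ (Function.invFun M m))) = (A.image φ).image M := by
        ext x
        simp [hinv]
      rw [this]
      exact isSpreading_schreierOne.image (f := id) (strictMono_id.strictMonoOn _)
        (hM.strictMonoOn _) (fun a _ => hM.le_apply) (by rwa [Finset.image_id])
    · intro k hk
      obtain ⟨x, hx, rfl⟩ := Finset.mem_image.1 hk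
      obtain ⟨a, ha, rfl⟩ := Finset.mem_image.1 hx
      convert hA _ (h5 _ (Finset.mem_image_of_mem φ ha)) using 1
      ext y
      simp only [Finset.mem_filter, Finset.mem_image, hinv]
      constructor
      · rintro ⟨⟨b, hb, rfl⟩, hba⟩
        rw [hinv] at hba
        exact ⟨b, ⟨hb, hM.injective hba⟩, rfl⟩
      · rintro ⟨b, ⟨hb, hba⟩, rfl⟩
        exact ⟨⟨b, hb, rfl⟩, by rw [hinv, hba]⟩
  | limit α hl ih =>
    have hl' : Order.IsSuccLimit (β + α) := Ordinal.isSuccLimit_add β hl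
    have hcβα := hc _ h hl'
    have hα : α < ω₁ := (le_add_left le_rfl : α ≤ β + α).trans_lt h
    have hex : ∀ n, ∃ α' < α, c (β + α) n ≤ β + α' := by
      intro n
      obtain ⟨α', h1, h2⟩ := (Ordinal.lt_add_iff_of_isSuccLimit hl).1 (hcβα.2.1 n)
      exact ⟨α', h1, h2.le⟩
    choose α' hα' hcα' using hex
    have hlt : ∀ n, β + α' n < ω₁ := fun n => (add_le_add_right (hα' n).le β).trans_lt h
    choose M hM hMA using fun n => ih (α' n) (hα' n) (hlt n)
    choose k hk using fun n => schreier_eventually_subset hc hα (hα' n).le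
    choose l hl'' using fun n => schreier_eventually_subset hc (hlt n) (hcα' n)
    -- `N` dominates at `i` the requirements of every `n ≤ i`. That is enough, since a member of the
    -- limit class that comes from stage `n` has all its elements at least `n`.
    obtain ⟨N, hN, hNle⟩ := exists_strictMono_ge fun i =>
      ∑ n ∈ Finset.range (i + 1), (M n (i + l n) + k n)
    have hNge : ∀ n i, n ≤ i → M n (i + l n) + k n ≤ N i := fun n i hni =>
      (Finset.single_le_sum (f := fun n => M n (i + l n) + k n) (fun _ _ => Nat.zero_le _)
        (Finset.mem_range.2 (by omega))).trans (hNle i)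
    refine ⟨N, hN, fun A hA => ?_⟩
    rw [schreier_limit c _ hl'] at hA
    obtain ⟨n, -, hA, hnA⟩ := hA
    have h1 : A.image (fun i => i + l n) ∈ schreier c (c (β + α) n) :=
      (isSpreading_schreier c _).image (f := id) (strictMono_id.strictMonoOn _)
        (fun a _ b _ hab => Nat.add_lt_add_right hab _) (fun a _ => Nat.le_add_right _ _)
        (by rwa [Finset.image_id])
    have h2 := hl'' n _ h1 (by
      intro a ha
      obtain ⟨b, _, rfl⟩ := Finset.mem_image.1 ha
      omega)
    have h3 := hMA n _ h2
    rw [Finset.image_image] at h3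
    have h4 : A.image N ∈ familyComp (schreier c (α' n)) (schreier c β) := by
      refine ((isSpreading_schreier c _).familyComp (isSpreading_schreier c _)).image
        ?_ (hN.strictMonoOn _) ?_ h3
      · intro a _ b _ hab
        exact hM n (Nat.add_lt_add_right hab _)
      · intro a ha
        exact (Nat.le_add_right _ _).trans (hNge n a (hnA a ha))
    obtain ⟨φ, h5, h6, h7, -, h8, h9⟩ := exists_coloring_of_mem_familyComp h4
    refine mem_familyComp_of_coloring (isSpreading_schreier c α) φ h5 h6 (hk n _ h8 ?_) h9
    intro x hx
    obtain ⟨y, hy, rfl⟩ := Finset.mem_image.1 hx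
    obtain ⟨a, ha, hay⟩ := Finset.mem_image.1 (h7 y hy)
    rw [← hay]
    exact (Nat.le_add_left _ _).trans (hNge n a (hnA a ha))

/-- The sets obtained from members of `F` by moving each element `i` to some place beyond `M i`. -/
def sparseFamily (M : ℕ → ℕ) (F : Set (Finset ℕ)) : Set (Finset ℕ) :=
  {A | ∃ g : ℕ → ℕ, StrictMonoOn g A ∧ A.image g ∈ F ∧ ∀ a ∈ A, M (g a) ≤ a}

theorem sparseFamily_anti {M M' : ℕ → ℕ} (h : ∀ i, M i ≤ M' i) (F : Set (Finset ℕ)) :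
    sparseFamily M' F ⊆ sparseFamily M F := by
  rintro A ⟨g, h1, h2, h3⟩
  exact ⟨g, h1, h2, fun a ha => (h _).trans (h3 a ha)⟩

theorem IsSpreading.sparseFamily {F : Set (Finset ℕ)} (hF : IsSpreading F) (M : ℕ → ℕ) :
    IsSpreading (sparseFamily M F) := by
  rintro A ⟨f, h1, h2, h3⟩ B g hg hgA hgle
  refine ⟨f ∘ g, fun a ha b hb hab => h1 (hgA a ha) (hgA b hb) (hg ha hb hab),
    hF.subset h2 ?_, fun b hb => (h3 _ (hgA b hb)).trans (hgle b hb)⟩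
  intro x hx
  obtain ⟨b, hb, rfl⟩ := Finset.mem_image.1 hx
  exact Finset.mem_image_of_mem f (hgA b hb)

/-- The reverse comparison, by the same induction. Sparseness pushes the left ends of the pieces
beyond the finitely many integers where inclusions between classes fail. The condition `i ≤ M i`
keeps the transported colours below the points they colour in the successor step. -/
theorem exists_familyComp_sparseFamily_subset {c : Ordinal.{0} → ℕ → Ordinal.{0}}
    (hc : IsLimitChoice c) {α β : Ordinal.{0}} (h : β + α < ω₁) :
    ∃ M : ℕ → ℕ, (∀ i, i ≤ M i) ∧
      familyComp (sparseFamily M (schreier c α)) (schreier c β) ⊆ schreier c (β + α) := by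
  classical
  induction α using Ordinal.limitRecOn with
  | zero =>
    refine ⟨id, fun i => le_rfl, fun A hA => ?_⟩
    obtain ⟨φ, -, -, -, -, ⟨g, hg, hgA, -⟩, h6⟩ := exists_coloring_of_mem_familyComp hA
    rw [add_zero] at h ⊢
    rw [schreier_zero] at hgA
    have hcard : (A.image φ).card ≤ 1 := by
      rw [← Finset.card_image_of_injOn hg.injOn]
      rcases hgA with h | ⟨i, h⟩ <;> rw [h] <;> simp
    rcases A.eq_empty_or_nonempty with rfl | ⟨a, ha⟩
    · exact empty_mem_schreier hc h
    · convert h6 (φ a) (Finset.mem_image_of_mem _ ha) using 1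
      refine (Finset.filter_true_of_mem fun b hb => ?_).symm
      exact Finset.card_le_one.1 hcard _ (Finset.mem_image_of_mem _ hb) _
        (Finset.mem_image_of_mem _ ha)
  | add_one α ih =>
    rw [← Order.succ_eq_add_one] at *
    rw [ordinal_add_succ] at h ⊢
    obtain ⟨M, hM, hsub⟩ := ih ((Order.lt_succ _).trans h)
    refine ⟨M, hM, ?_⟩
    have key : sparseFamily M (schreier c (Order.succ α)) ⊆
        familyComp schreierOne (sparseFamily M (schreier c α)) := by
      rintro A ⟨g, hg, hgA, hgM⟩
      rw [schreier_succ] at hgA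
      obtain ⟨φ, h1, h2, -, -, h4, h5⟩ := exists_coloring_of_mem_familyComp hgA
      have him : ∀ a ∈ A, g a ∈ A.image g := fun a ha => Finset.mem_image_of_mem _ ha
      refine mem_familyComp_of_coloring isSpreading_schreierOne (fun a => φ (g a)) ?_ ?_ ?_ ?_
      · intro a ha b hb hab
        exact h1 (him a ha) (him b hb) (hg.monotoneOn ha hb hab)
      · intro a ha
        exact (h2 _ (him a ha)).trans ((hM _).trans (hgM a ha))
      · rw [Finset.image_image] at h4
        exact h4
      · intro k hk
        obtain ⟨a, ha, rfl⟩ := Finset.mem_image.1 hk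
        refine ⟨g, hg.mono fun x hx => (Finset.mem_filter.1 hx).1, ?_,
          fun x hx => hgM x (Finset.mem_filter.1 hx).1⟩
        refine (isSpreading_schreier c α).subset (h5 _ (Finset.mem_image_of_mem φ (him a ha))) ?_
        intro x hx
        obtain ⟨y, hy, rfl⟩ := Finset.mem_image.1 hx
        rw [Finset.mem_filter] at hy ⊢
        exact ⟨him y hy.1, hy.2⟩
    rw [schreier_succ c (β + α)]
    calc familyComp (sparseFamily M (schreier c (Order.succ α))) (schreier c β)
        ⊆ familyComp (familyComp schreierOne (sparseFamily M (schreier c α))) (schreier c β) :=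
          familyComp_mono key subset_rfl
      _ ⊆ familyComp schreierOne (familyComp (sparseFamily M (schreier c α)) (schreier c β)) :=
          familyComp_assoc_superset isSpreading_schreierOne
            ((isSpreading_schreier c α).sparseFamily M) (isSpreading_schreier c β)
      _ ⊆ familyComp schreierOne (schreier c (β + α)) := familyComp_mono subset_rfl hsub
  | limit α hl ih =>
    have hα : α < ω₁ := (le_add_left le_rfl : α ≤ β + α).trans_lt h
    have hcα := hc α hα hl
    have hlt : ∀ n, β + c α n < ω₁ := fun n =>
      (add_le_add_right (hcα.2.1 n).le β).trans_lt h
    choose M hM hMsub using fun n => ih (c α n) (hcα.2.1 n) (hlt n)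
    choose k hk using fun n => schreier_eventually_subset hc h
      (add_le_add_right (hcα.2.1 n).le β)
    refine ⟨fun i => i + ∑ n ∈ Finset.range (i + 1), (M n i + k n),
      fun i => Nat.le_add_right _ _, fun A hA => ?_⟩
    have hge : ∀ n i, n ≤ i →
        M n i + k n ≤ i + ∑ n ∈ Finset.range (i + 1), (M n i + k n) := fun n i hni =>
      (Finset.single_le_sum (f := fun n => M n i + k n) (fun _ _ => Nat.zero_le _)
        (Finset.mem_range.2 (by omega))).trans (Nat.le_add_left _ _)
    obtain ⟨ψ, h1, h2, -, -, ⟨g, hg, hgA, hgM⟩, h6⟩ := exists_coloring_of_mem_familyComp hA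
    rw [schreier_limit c α hl] at hgA
    obtain ⟨n, -, hgA, hn⟩ := hgA
    have him : ∀ a ∈ A, ψ a ∈ A.image ψ := fun a ha => Finset.mem_image_of_mem _ ha
    have hge' : ∀ x ∈ A.image ψ, M n (g x) + k n ≤ x := fun x hx =>
      (hge n (g x) (hn _ (Finset.mem_image_of_mem g hx))).trans (hgM x hx)
    refine hk n A (hMsub n ?_) ?_
    · refine mem_familyComp_of_coloring ((isSpreading_schreier c _).sparseFamily _) ψ h1 h2
        ⟨g, hg, hgA, fun x hx => (Nat.le_add_right _ _).trans (hge' x hx)⟩ h6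
    · intro a ha
      exact ((Nat.le_add_left _ _).trans (hge' _ (him a ha))).trans (h2 a ha)

/-! ### Lower `ℓ₁` estimates and the constants `δ_α` -/

section LowerEstimates

variable {E : Type*} [NormedAddCommGroup E] [NormedSpace ℝ E]

theorem minSupp_mem {a : ℕ →₀ ℝ} (ha : a ≠ 0) : minSupp a ∈ a.support := by
  have : (a.support : Set ℕ).Nonempty := by
    rw [Finset.coe_nonempty]
    exact Finsupp.support_nonempty_iff.2 ha
  exact Nat.sInf_mem this

theorem minSupp_le {a : ℕ →₀ ℝ} {s : ℕ} (hs : s ∈ a.support) : minSupp a ≤ s :=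
  Nat.sInf_le (Finset.mem_coe.2 hs)

theorem IsSuccessive.strictMono_minSupp {ι : Type*} [Preorder ι] {a : ι → ℕ →₀ ℝ}
    (h : IsSuccessive a) : StrictMono fun i => minSupp (a i) := fun i j hij =>
  h.2 i j hij _ (minSupp_mem (h.1 i)) _ (minSupp_mem (h.1 j))

/-- Lower `ℓ₁` estimate with constant `δ` for the successive vectors `v_i` (possibly zero) indexed
by `i ∈ A ∈ F`, where `v_i` is supported on `[i, ∞)`. -/
def LowerEstimate (F : Set (Finset ℕ)) (x : ℕ → E) (δ : ℝ) : Prop :=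
  ∀ A ∈ F, ∀ v : ℕ → ℕ →₀ ℝ, (∀ i ∈ A, ∀ s ∈ (v i).support, i ≤ s) →
    (∀ i ∈ A, ∀ j ∈ A, i < j → ∀ s ∈ (v i).support, ∀ t ∈ (v j).support, s < t) →
    δ * ∑ i ∈ A, ‖comb x (v i)‖ ≤ ‖∑ i ∈ A, comb x (v i)‖

theorem comb_zero (x : ℕ → E) : comb x 0 = 0 := map_zero _

theorem comb_single (x : ℕ → E) (i : ℕ) (r : ℝ) : comb x (Finsupp.single i r) = r • x i :=
  Finsupp.linearCombination_single _ _ _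

theorem deltaConst_mul_le {F : Set (Finset ℕ)} (x : ℕ → E) {k : ℕ} {a : Fin k → ℕ →₀ ℝ}
    (h : IsSuccessive a) (hF : IsAdmissible F a) :
    deltaConst F x * ∑ i, ‖comb x (a i)‖ ≤ ‖∑ i, comb x (a i)‖ := by
  have hS : 0 ≤ ∑ i, ‖comb x (a i)‖ := Finset.sum_nonneg fun _ _ => norm_nonneg _
  rcases hS.lt_or_eq with hS | hS
  · rw [← le_div_iff₀ hS]
    refine csSup_le ⟨0, le_rfl, fun k a _ _ => by simp⟩ ?_
    rintro δ ⟨-, hδ⟩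
    rw [le_div_iff₀ hS]
    exact hδ k a h hF
  · rw [← hS]; simp

theorem deltaConst_nonneg (F : Set (Finset ℕ)) (x : ℕ → E) : 0 ≤ deltaConst F x :=
  Real.sSup_nonneg fun _ h => h.1

/-- Zero vectors are discarded and each index `i` is moved right to `minSupp (v i)`; spreading keeps
the resulting set in `F`. -/
theorem lowerEstimate_deltaConst {F : Set (Finset ℕ)} (hF : IsSpreading F) (x : ℕ → E) :
    LowerEstimate F x (deltaConst F x) := by
  classical
  intro A hA v hle hlt
  let A' := A.filter fun i => v i ≠ 0
  have hA'A : ∀ i ∈ A', i ∈ A ∧ v i ≠ 0 := fun i hi => Finset.mem_filter.1 hi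
  let o := A'.orderEmbOfFin rfl
  have ho : ∀ j, o j ∈ A' := fun j => Finset.orderEmbOfFin_mem _ _ j
  have hsucc : IsSuccessive fun j => v (o j) :=
    ⟨fun j => (hA'A _ (ho j)).2, fun i j hij =>
      hlt _ (hA'A _ (ho i)).1 _ (hA'A _ (ho j)).1 (o.strictMono hij)⟩
  have hmap : A' = Finset.univ.map o.toEmbedding := (Finset.map_orderEmbOfFin_univ _ _).symm
  have hadm : IsAdmissible F fun j => v (o j) := by
    have : A'.image (fun i => minSupp (v i)) ∈ F := by
      refine hF.image (f := id) (strictMono_id.strictMonoOn _) ?_ ?_ ?_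
      · intro i hi j hj hij
        exact hlt _ (hA'A _ hi).1 _ (hA'A _ hj).1 hij _ (minSupp_mem (hA'A _ hi).2) _
          (minSupp_mem (hA'A _ hj).2)
      · intro i hi
        exact hle _ (hA'A _ hi).1 _ (minSupp_mem (hA'A _ hi).2)
      · rw [Finset.image_id]
        exact hF.subset hA (Finset.filter_subset _ _)
    rw [hmap, Finset.map_eq_image, Finset.image_image] at this
    exact this
  have h := deltaConst_mul_le x hsucc hadm
  have h1 : ∑ i ∈ A, ‖comb x (v i)‖ = ∑ j, ‖comb x (v (o j))‖ := by
    have : ∑ i ∈ A', ‖comb x (v i)‖ = ∑ i ∈ A, ‖comb x (v i)‖ := by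
      refine Finset.sum_filter_of_ne fun i _ hne h0 => hne ?_
      rw [h0, comb_zero, norm_zero]
    exact this.symm.trans ((congrArg (fun B => Finset.sum B _) hmap).trans (Finset.sum_map _ _ _))
  have h2 : ∑ i ∈ A, comb x (v i) = ∑ j, comb x (v (o j)) := by
    have : ∑ i ∈ A', comb x (v i) = ∑ i ∈ A, comb x (v i) := by
      refine Finset.sum_filter_of_ne fun i _ hne h0 => hne ?_
      rw [h0, comb_zero]
    exact this.symm.trans ((congrArg (fun B => Finset.sum B _) hmap).trans (Finset.sum_map _ _ _))
  rw [h1, h2]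
  exact h

/-- A successive family indexed by `Fin k` can be indexed by the minima of its supports. -/
theorem IsSuccessive.exists_reindex {k : ℕ} {a : Fin k → ℕ →₀ ℝ} (h : IsSuccessive a) :
    ∃ v : ℕ → ℕ →₀ ℝ, (∀ i, v (minSupp (a i)) = a i) ∧
      (∀ m ∈ Finset.univ.image (fun i => minSupp (a i)), ∀ s ∈ (v m).support, m ≤ s) ∧
      (∀ m ∈ Finset.univ.image (fun i => minSupp (a i)),
        ∀ m' ∈ Finset.univ.image (fun i => minSupp (a i)), m < m' →
        ∀ s ∈ (v m).support, s < m') := by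
  classical
  have hinj := h.strictMono_minSupp.injective
  have hv : ∀ i, Function.extend (fun i => minSupp (a i)) a 0 (minSupp (a i)) = a i := fun i =>
    hinj.extend_apply a 0 i
  refine ⟨Function.extend (fun i => minSupp (a i)) a 0, hv, ?_, ?_⟩
  · intro m hm s hs
    obtain ⟨i, -, rfl⟩ := Finset.mem_image.1 hm
    rw [hv] at hs
    exact minSupp_le hs
  · intro m hm m' hm' hlt s hs
    obtain ⟨i, -, rfl⟩ := Finset.mem_image.1 hm
    obtain ⟨j, -, rfl⟩ := Finset.mem_image.1 hm'
    rw [hv] at hs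
    exact h.2 i j (h.strictMono_minSupp.lt_iff_lt.1 hlt) s hs _ (minSupp_mem (h.1 j))

/-- The one-term block `x 0` forces `δ ≤ 1`. Without such a bound the real `sSup` could take its
default value `0`. -/
theorem bddAbove_deltaConst {F : Set (Finset ℕ)} {x : ℕ → E} (hF : {0} ∈ F) (hx : x 0 ≠ 0) :
    (1 : ℝ) ∈ upperBounds {δ : ℝ | 0 ≤ δ ∧ ∀ (k : ℕ) (a : Fin k → ℕ →₀ ℝ), IsSuccessive a →
      IsAdmissible F a → δ * ∑ i, ‖comb x (a i)‖ ≤ ‖∑ i, comb x (a i)‖} := by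
  rintro δ ⟨-, h⟩
  have hms : minSupp (Finsupp.single 0 (1 : ℝ)) = 0 := by
    refine Nat.le_zero.1 (minSupp_le ?_)
    simp
  have := h 1 (fun _ => Finsupp.single 0 1)
    ⟨fun _ => by simp, fun i j hij => absurd hij (by simp [Subsingleton.elim i j])⟩ (by
      simpa only [IsAdmissible, hms, Finset.univ_unique, Finset.image_singleton] using hF)
  simp only [comb_single, Finset.univ_unique, Finset.sum_singleton, one_smul] at this
  have hpos : 0 < ‖x 0‖ := norm_pos_iff.2 hx
  nlinarith

theorem deltaConst_le_one {F : Set (Finset ℕ)} {x : ℕ → E} (hF : {0} ∈ F) (hx : x 0 ≠ 0) :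
    deltaConst F x ≤ 1 :=
  csSup_le ⟨0, le_rfl, fun k a _ _ => by simp⟩ (bddAbove_deltaConst hF hx)

theorem LowerEstimate.le_deltaConst {F : Set (Finset ℕ)} {x : ℕ → E} {δ : ℝ} (hF : {0} ∈ F)
    (hx : x 0 ≠ 0) (hδ : 0 ≤ δ) (h : LowerEstimate F x δ) : δ ≤ deltaConst F x := by
  refine le_csSup ⟨1, bddAbove_deltaConst hF hx⟩ ⟨hδ, fun k a ha hadm => ?_⟩
  obtain ⟨v', h1', h2', h3'⟩ := ha.exists_reindex
  have := h _ hadm v' h2' fun m hm m' hm' hlt s hs t ht =>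
    (h3' m hm m' hm' hlt s hs).trans_le (h2' m' hm' t ht)
  have hinj := ha.strictMono_minSupp.injective
  rw [Finset.sum_image fun i _ j _ hij => hinj hij,
    Finset.sum_image fun i _ j _ hij => hinj hij] at this
  simpa only [h1'] using this

theorem exists_lt_of_deltaConst_lt {F : Set (Finset ℕ)} {x : ℕ → E} {δ : ℝ} (hF : {0} ∈ F)
    (hx : x 0 ≠ 0) (h : deltaConst F x < δ) :
    ∃ (k : ℕ) (a : Fin k → ℕ →₀ ℝ), IsSuccessive a ∧ IsAdmissible F a ∧
      ‖∑ i, comb x (a i)‖ < δ * ∑ i, ‖comb x (a i)‖ := by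
  by_contra! hcon
  exact absurd h (not_lt.2 (le_csSup ⟨1, bddAbove_deltaConst hF hx⟩
    ⟨(deltaConst_nonneg F x).trans h.le, fun k a => hcon k a⟩))

/-- The estimate for `F` is applied to the sums over the pieces, then the estimate for `G` inside
each piece, so the constants multiply. -/
theorem LowerEstimate.familyComp {F G : Set (Finset ℕ)} {x : ℕ → E} {s t : ℝ} (hs : 0 ≤ s)
    (hF : LowerEstimate F x s) (hG : LowerEstimate G x t) :
    LowerEstimate (familyComp F G) x (s * t) := by
  classical
  intro A hA v hle hlt
  obtain ⟨φ, h1, h2, -, -, h3, h4⟩ := exists_coloring_of_mem_familyComp hA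
  have hmaps : ∀ a ∈ A, φ a ∈ A.image φ := fun a ha => Finset.mem_image_of_mem _ ha
  have hsupp : ∀ l, ∀ r ∈ (∑ i ∈ A with φ i = l, v i).support,
      ∃ i ∈ A, φ i = l ∧ r ∈ (v i).support := by
    intro l r hr
    obtain ⟨i, hi, hir⟩ := Finset.mem_biUnion.1 (Finsupp.support_finsetSum hr)
    exact ⟨i, (Finset.mem_filter.1 hi).1, (Finset.mem_filter.1 hi).2, hir⟩
  have hcomb : ∀ l, comb x (∑ i ∈ A with φ i = l, v i) = ∑ i ∈ A with φ i = l, comb x (v i) :=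
    fun l => map_sum _ _ _
  have key := hF _ h3 (fun l => ∑ i ∈ A with φ i = l, v i) (by
      intro l _ r hr
      obtain ⟨i, hi, rfl, hir⟩ := hsupp l r hr
      exact (h2 i hi).trans (hle i hi r hir)) (by
      intro l _ l' _ hll r hr r' hr'
      obtain ⟨i, hi, rfl, hir⟩ := hsupp l r hr
      obtain ⟨j, hj, rfl, hjr⟩ := hsupp l' r' hr'
      refine hlt i hi j hj ?_ r hir r' hjr
      by_contra hcon
      exact absurd hll (not_lt.2 (h1 hj hi (not_lt.1 hcon))))
  simp only [hcomb] at key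
  rw [Finset.sum_fiberwise_of_maps_to hmaps] at key
  refine le_trans ?_ key
  rw [mul_assoc]
  refine mul_le_mul_of_nonneg_left ?_ hs
  rw [← Finset.sum_fiberwise_of_maps_to hmaps, Finset.mul_sum]
  refine Finset.sum_le_sum fun l hl => ?_
  refine hG _ (h4 l hl) v ?_ ?_
  · intro i hi
    exact hle i (Finset.mem_filter.1 hi).1
  · intro i hi j hj
    exact hlt i (Finset.mem_filter.1 hi).1 j (Finset.mem_filter.1 hj).1

theorem comb_comp (x : ℕ → E) (M : ℕ → ℕ) (a : ℕ →₀ ℝ) :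
    comb (x ∘ M) a = comb x (a.mapDomain M) :=
  (Finsupp.linearCombination_mapDomain ℝ M a).symm

theorem LowerEstimate.comp {F H : Set (Finset ℕ)} {x : ℕ → E} {δ : ℝ} {M : ℕ → ℕ}
    (hM : StrictMono M) (hH : LowerEstimate H x δ) (hFH : ∀ A ∈ F, A.image M ∈ H) :
    LowerEstimate F (x ∘ M) δ := by
  classical
  intro A hA v hle hlt
  have hinv : ∀ a, Function.invFun M (M a) = a := Function.leftInverse_invFun hM.injective
  have hsupp : ∀ i, ∀ r ∈ ((v i).mapDomain M).support, ∃ s ∈ (v i).support, r = M s := by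
    intro i r hr
    obtain ⟨s, hs, h⟩ := Finset.mem_image.1 (Finsupp.mapDomain_support hr)
    exact ⟨s, hs, h.symm⟩
  have := hH _ (hFH A hA) (fun m => (v (Function.invFun M m)).mapDomain M) (by
    intro m hm r hr
    obtain ⟨i, hi, rfl⟩ := Finset.mem_image.1 hm
    obtain ⟨s, hs, rfl⟩ := hsupp _ r hr
    rw [hinv] at hs
    exact hM.monotone (hle i hi s hs)) (by
    intro m hm m' hm' hmm r hr r' hr'
    obtain ⟨i, hi, rfl⟩ := Finset.mem_image.1 hm
    obtain ⟨j, hj, rfl⟩ := Finset.mem_image.1 hm'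
    obtain ⟨s, hs, rfl⟩ := hsupp _ r hr
    obtain ⟨t, ht, rfl⟩ := hsupp _ r' hr'
    rw [hinv] at hs ht
    exact hM (hlt i hi j hj (hM.lt_iff_lt.1 hmm) s hs t ht))
  rw [Finset.sum_image hM.injective.injOn, Finset.sum_image hM.injective.injOn] at this
  simpa only [hinv, ← comb_comp] using this

/-- The subsequence `M` is independent of `x`, so it serves all tails at once; a stabilized `γ` does
not see the passage to `x ∘ M`. -/
theorem deltaConst_mul_deltaConst_le {c : Ordinal.{0} → ℕ → Ordinal.{0}} (hc : IsLimitChoice c)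
    {α β : Ordinal.{0}} (h : β + α < ω₁) :
    ∃ M : ℕ → ℕ, StrictMono M ∧ ∀ x : ℕ → E, (∀ i, x i ≠ 0) →
      deltaConst (schreier c α) x * deltaConst (schreier c β) x ≤
        deltaConst (schreier c (β + α)) (x ∘ M) := by
  obtain ⟨M, hM, hMA⟩ := exists_image_mem_familyComp hc h
  refine ⟨M, hM, fun x hx => ?_⟩
  refine LowerEstimate.le_deltaConst (singleton_mem_schreier hc h 0) (hx _)
    (mul_nonneg (deltaConst_nonneg _ _) (deltaConst_nonneg _ _)) ?_
  exact LowerEstimate.comp hM (LowerEstimate.familyComp (deltaConst_nonneg _ _)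
    (lowerEstimate_deltaConst (isSpreading_schreier c α) x)
    (lowerEstimate_deltaConst (isSpreading_schreier c β) x)) hMA

theorem isBlockBasis_comp (x : ℕ → E) {M : ℕ → ℕ} (hM : StrictMono M) :
    IsBlockBasis (x ∘ M) x := by
  refine ⟨fun j => Finsupp.single (M j) 1, ⟨fun j => by simp, fun i j hij s hs t ht => ?_⟩,
    fun j => by simp [comb_single]⟩
  rw [Finsupp.mem_support_iff, Finsupp.single_apply_ne_zero] at hs ht
  rw [hs.1, ht.1]
  exact hM hij

theorem isBlockBasis_refl (x : ℕ → E) : IsBlockBasis x x :=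
  isBlockBasis_comp x strictMono_id

end LowerEstimates

/-! ### Supermultiplicativity of `γ` and the limit `γ̂_α` -/

section Spectrum

variable {E : Type*} [NormedAddCommGroup E] [NormedSpace ℝ E]
  {c : Ordinal.{0} → ℕ → Ordinal.{0}} {y : ℕ → E} {γ : Ordinal.{0} → ℝ}

theorem DeltaStabilizes.tendsto_deltaConst (h : DeltaStabilizes c y γ) {α : Ordinal.{0}}
    (hα : α < ω₁) {z : ℕ → ℕ → E} (hz : ∀ n, IsBlockBasis (z n) fun i => y (n + i)) :
    Tendsto (fun n => deltaConst (schreier c α) (z n)) atTop (𝓝 (γ α)) := by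
  obtain ⟨ε, -, hε, h⟩ := h
  obtain ⟨m, hm⟩ := h α hα
  rw [tendsto_iff_norm_sub_tendsto_zero]
  refine squeeze_zero' (Eventually.of_forall fun _ => norm_nonneg _) ?_ hε
  filter_upwards [eventually_ge_atTop m] with n hn
  exact (hm n hn _ (hz n)).le

theorem DeltaStabilizes.le_one (h : DeltaStabilizes c y γ) (hc : IsLimitChoice c)
    (hy : ∀ i, y i ≠ 0) {α : Ordinal.{0}} (hα : α < ω₁) : γ α ≤ 1 :=
  le_of_tendsto' (h.tendsto_deltaConst hα fun _ => isBlockBasis_refl _)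
    fun _ => deltaConst_le_one (singleton_mem_schreier hc hα 0) (hy _)

theorem DeltaStabilizes.mul_le (h : DeltaStabilizes c y γ) (hc : IsLimitChoice c)
    (hy : ∀ i, y i ≠ 0) {α β : Ordinal.{0}} (hα : α < ω₁) (hβ : β < ω₁) (hαβ : β + α < ω₁) :
    γ α * γ β ≤ γ (β + α) := by
  obtain ⟨M, hM, hle⟩ := deltaConst_mul_deltaConst_le (E := E) hc hαβ
  have hid : ∀ n, IsBlockBasis (fun i => y (n + i)) (fun i => y (n + i)) := fun _ =>
    isBlockBasis_refl _
  exact le_of_tendsto_of_tendsto'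
    ((h.tendsto_deltaConst hα hid).mul (h.tendsto_deltaConst hβ hid))
    (h.tendsto_deltaConst hαβ fun n => isBlockBasis_comp _ hM) fun n => hle _ fun i => hy _

theorem mul_nat_lt_omega_one {α : Ordinal.{0}} (hα : α < ω₁) (n : ℕ) : α * n < ω₁ :=
  Ordinal.isPrincipal_mul_omega 1 hα
    ((Ordinal.natCast_lt_omega0 n).trans Ordinal.omega0_lt_omega_one)

/-- Fekete's lemma for supermultiplicative sequences in `(0, 1]`. -/
theorem exists_tendsto_rpow_of_supermultiplicative {a : ℕ → ℝ} (hpos : ∀ n, 0 < a n)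
    (hle : ∀ n, a n ≤ 1) (hmul : ∀ m n, a m * a n ≤ a (m + n)) :
    ∃ θ : ℝ, 0 < θ ∧ Tendsto (fun n : ℕ => a n ^ (1 / (n : ℝ))) atTop (𝓝 θ) := by
  have hsub : Subadditive fun n => -Real.log (a n) := by
    intro m n
    have := Real.log_le_log (mul_pos (hpos m) (hpos n)) (hmul m n)
    rw [Real.log_mul (hpos m).ne' (hpos n).ne'] at this
    linarith
  have hbdd : BddBelow (Set.range fun n : ℕ => -Real.log (a n) / n) := by
    refine ⟨0, ?_⟩
    rintro _ ⟨n, rfl⟩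
    have := Real.log_nonpos (hpos n).le (hle n)
    exact div_nonneg (by linarith) (Nat.cast_nonneg n)
  refine ⟨Real.exp (-hsub.lim), Real.exp_pos _, ?_⟩
  refine ((Real.continuous_exp.tendsto _).comp (hsub.tendsto_lim hbdd).neg).congr fun n => ?_
  simp only [Function.comp]
  rw [Real.rpow_def_of_pos (hpos n)]
  congr 1
  ring

theorem DeltaStabilizes.exists_gammaHat (h : DeltaStabilizes c y γ) (hc : IsLimitChoice c)
    (hy : ∀ i, y i ≠ 0) {α : Ordinal.{0}} (hα : α < ω₁) (hpos : 0 < γ α) :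
    (∀ n : ℕ, n ≠ 0 → 0 < γ (α * n)) ∧ 0 < gammaHat γ α ∧
      Tendsto (fun n : ℕ => γ (α * n) ^ (1 / (n : ℝ))) atTop (𝓝 (gammaHat γ α)) := by
  have hmul : ∀ m n : ℕ, γ (α * m) * γ (α * n) ≤ γ (α * (m + n : ℕ)) := by
    intro m n
    have heq : α * (m + n : ℕ) = α * n + α * m := by
      rw [add_comm m n, Nat.cast_add, mul_add]
    rw [heq]
    exact h.mul_le hc hy (mul_nat_lt_omega_one hα m) (mul_nat_lt_omega_one hα n)
      (heq ▸ mul_nat_lt_omega_one hα (m + n))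
  have hpos' : ∀ n : ℕ, 0 < γ (α * (n + 1 : ℕ)) := by
    intro n
    induction n with
    | zero => simpa using hpos
    | succ n ih =>
      have := hmul (n + 1) 1
      rw [Nat.cast_one, mul_one] at this
      exact (mul_pos ih hpos).trans_le this
  have hpos'' : ∀ n : ℕ, n ≠ 0 → 0 < γ (α * n) := by
    intro n hn
    obtain ⟨k, rfl⟩ := Nat.exists_eq_succ_of_ne_zero hn
    exact hpos' k
  -- The term at `n = 0` is replaced by `1`, which makes supermultiplicativity trivial there and
  -- leaves the limit unchanged.
  obtain ⟨θ, hθ, hlim⟩ := exists_tendsto_rpow_of_supermultiplicative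
    (a := fun n : ℕ => if n = 0 then 1 else γ (α * n))
    (by intro n; split_ifs with hn; exacts [one_pos, hpos'' n hn])
    (by
      intro n; split_ifs
      exacts [le_rfl, h.le_one hc hy (mul_nat_lt_omega_one hα n)])
    (by
      intro m n
      rcases eq_or_ne m 0 with rfl | hm
      · simp
      rcases eq_or_ne n 0 with rfl | hn
      · simp
      simpa only [hm, hn, if_false, Nat.add_eq_zero_iff, false_and] using hmul m n)
  have hlim' : Tendsto (fun n : ℕ => γ (α * n) ^ (1 / (n : ℝ))) atTop (𝓝 θ) := by
    refine hlim.congr' ?_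
    filter_upwards [eventually_ne_atTop 0] with n hn
    rw [if_neg hn]
  have heq : gammaHat γ α = θ := hlim'.limUnder_eq
  exact ⟨hpos'', heq ▸ hθ, heq ▸ hlim'⟩

end Spectrum

/-! ### Norms given by admissible families of interval projections -/

section Cut

variable {E : Type*} [NormedAddCommGroup E] [NormedSpace ℝ E] (b : SchauderBasis ℝ E) (K : ℕ)

/-- The tail `b_K, b_{K+1}, …` of the basis `b`. -/
def tail : ℕ → E := fun i => b (K + i)

/-- The projection onto the span of the terms of the tail `tail b K` with index in `[p, q)`. -/
def cut (p q : ℕ) : E →L[ℝ] E := GeneralSchauderBasis.proj b (Finset.Ico (K + p) (K + q))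

variable {b K}

theorem exists_cut_eq_comb (p q : ℕ) (x : E) :
    ∃ v : ℕ →₀ ℝ, (∀ s ∈ v.support, p ≤ s ∧ s < q) ∧ cut b K p q x = comb (tail b K) v := by
  classical
  refine ⟨∑ i ∈ Finset.Ico p q, Finsupp.single i (b.coord (K + i) x), ?_, ?_⟩
  · intro s hs
    obtain ⟨i, hi, his⟩ := Finset.mem_biUnion.1 (Finsupp.support_finsetSum hs)
    have : s = i := Finset.mem_singleton.1 (Finsupp.support_single_subset his)
    rw [this]
    exact Finset.mem_Ico.1 hi
  · have : Finset.Ico (K + p) (K + q) = (Finset.Ico p q).map (addLeftEmbedding K) := by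
      rw [Finset.map_add_left_Ico]
    rw [cut, GeneralSchauderBasis.proj_apply, this, Finset.sum_map, comb, map_sum]
    refine Finset.sum_congr rfl fun i _ => ?_
    rw [Finsupp.linearCombination_single]
    rfl

theorem cut_comb (p q : ℕ) (a : ℕ →₀ ℝ) :
    cut b K p q (comb (tail b K) a) =
      comb (tail b K) (a.filter fun i => p ≤ i ∧ i < q) := by
  classical
  induction a using Finsupp.induction_linear with
  | zero => rw [comb_zero, map_zero, Finsupp.filter_zero, comb_zero]
  | add f g hf hg =>
    have h : ∀ f g : ℕ →₀ ℝ, comb (tail b K) (f + g) = comb (tail b K) f + comb (tail b K) g :=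
      fun f g => map_add _ f g
    rw [h, map_add, hf, hg, Finsupp.filter_add, h]
  | single i r =>
    rw [comb_single, map_smul, cut, tail, GeneralSchauderBasis.proj_apply_basis_mem]
    simp only [Finset.mem_Ico, add_le_add_iff_left, add_lt_add_iff_left]
    by_cases h : p ≤ i ∧ i < q
    · rw [if_pos h, Finsupp.filter_single_of_pos (fun i => p ≤ i ∧ i < q) h, comb_single, tail]
    · rw [if_neg h, Finsupp.filter_single_of_neg (fun i => p ≤ i ∧ i < q) h, comb_zero, smul_zero]

theorem cut_cut {p q p' q' : ℕ} (hp : p' ≤ p) (hq : q ≤ q') (x : E) :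
    cut b K p q (cut b K p' q' x) = cut b K p q x := by
  rw [cut, cut, GeneralSchauderBasis.proj_comp]
  refine congrArg (fun A => GeneralSchauderBasis.proj b A x) ?_
  ext i
  simp only [Finset.mem_inter, Finset.mem_Ico]
  omega

theorem cut_add {p q r : ℕ} (hpq : p ≤ q) (hqr : q ≤ r) (x : E) :
    cut b K p q x + cut b K q r x = cut b K p r x := by
  simp only [cut, GeneralSchauderBasis.proj_apply]
  exact Finset.sum_Ico_consecutive _ (by omega) (by omega)

theorem cut_of_le {p q : ℕ} (h : q ≤ p) : cut b K p q = 0 := by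
  rw [cut, Finset.Ico_eq_empty (by omega), GeneralSchauderBasis.proj_empty]

theorem proj_add_cut (q : ℕ) (x : E) :
    SchauderBasis.proj b K x + cut b K 0 q x = SchauderBasis.proj b (K + q) x := by
  simp only [cut, SchauderBasis.proj_apply, GeneralSchauderBasis.proj_apply, add_zero]
  exact Finset.sum_range_add_sum_Ico _ (by omega)

theorem proj_comb_tail (a : ℕ →₀ ℝ) : SchauderBasis.proj b K (comb (tail b K) a) = 0 := by
  rw [comb, Finsupp.linearCombination_apply, Finsupp.sum, map_sum]
  refine Finset.sum_eq_zero fun i _ => ?_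
  rw [map_smul, tail, SchauderBasis.proj_apply_basis_mem, if_neg (by omega), smul_zero]

theorem cut_eq_sub {p q : ℕ} (h : p ≤ q) (x : E) :
    cut b K p q x = SchauderBasis.proj b (K + q) x - SchauderBasis.proj b (K + p) x := by
  simp only [cut, SchauderBasis.proj_apply, GeneralSchauderBasis.proj_apply]
  exact Finset.sum_Ico_eq_sub _ (by omega)

variable (b) in
theorem exists_norm_cut_le [CompleteSpace E] :
    ∃ B : ℝ, 0 < B ∧ ∀ (K p q : ℕ) (x : E), ‖cut b K p q x‖ ≤ B * ‖x‖ := by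
  obtain ⟨C, hC⟩ := SchauderBasis.exists_norm_proj_le b
  have hC0 : 0 ≤ C := (norm_nonneg _).trans (hC 0)
  refine ⟨2 * C + 1, by positivity, fun K p q x => ?_⟩
  rcases le_total q p with h | h
  · rw [cut_of_le h]
    simp only [zero_apply, norm_zero]
    positivity
  · have h2 : ∀ n, ‖SchauderBasis.proj b n x‖ ≤ C * ‖x‖ := fun n =>
      (ContinuousLinearMap.le_opNorm _ _).trans
        (mul_le_mul_of_nonneg_right (hC n) (norm_nonneg _))
    rw [cut_eq_sub h]
    have := norm_sub_le (SchauderBasis.proj b (K + q) x) (SchauderBasis.proj b (K + p) x)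
    have := h2 (K + q)
    have := h2 (K + p)
    have := norm_nonneg x
    linarith

theorem comb_sum {ι : Type*} (x : ℕ → E) (A : Finset ι) (v : ι → ℕ →₀ ℝ) :
    comb x (∑ j ∈ A, v j) = ∑ j ∈ A, comb x (v j) :=
  map_sum _ _ _

/-- Pairs `(A, q)` with `A ∈ F` that describe the successive intervals `[f, q f)`, `f ∈ A`. -/
def IntervalFamily (F : Set (Finset ℕ)) : Type :=
  {P : Finset ℕ × (ℕ → ℕ) // P.1 ∈ F ∧ ∀ f ∈ P.1, ∀ g ∈ P.1, f < g → P.2 f ≤ g}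

variable (b K) in
/-- The seminorm `x ↦ ∑_{f ∈ A} ‖P_{[f, q f)} x‖`. -/
def cutSum (A : Finset ℕ) (q : ℕ → ℕ) : Seminorm ℝ E :=
  ∑ f ∈ A, (normSeminorm ℝ E).comp (cut b K f (q f)).toLinearMap

theorem seminorm_sum_apply {ι : Type*} (s : Finset ι) (p : ι → Seminorm ℝ E) (x : E) :
    (∑ i ∈ s, p i) x = ∑ i ∈ s, p i x := by
  classical
  induction s using Finset.induction_on with
  | empty => simp
  | insert a s ha ih => rw [Finset.sum_insert ha, Finset.sum_insert ha, add_apply, ih]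

theorem cutSum_apply (A : Finset ℕ) (q : ℕ → ℕ) (x : E) :
    cutSum b K A q x = ∑ f ∈ A, ‖cut b K f (q f) x‖ := by
  rw [cutSum, seminorm_sum_apply]
  rfl

variable (b K) in
/-- The supremum of the seminorms `cutSum b K A q` over the families of intervals `(A, q)` with
`A ∈ F`. -/
def familySeminorm (F : Set (Finset ℕ)) : Seminorm ℝ E :=
  ⨆ P : IntervalFamily F, cutSum b K P.1.1 P.1.2

/-- Each interval `[f, q f)` is prolonged to the next left end in `A`, and the last one to `L`. The
gaps disappear, so the pieces telescope to one interval projection. -/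
theorem exists_next (A : Finset ℕ) (q : ℕ → ℕ) (hq : ∀ f ∈ A, ∀ g ∈ A, f < g → q f ≤ g) (L : ℕ)
    (hL : ∀ f ∈ A, f ≤ L ∧ q f ≤ L) :
    ∃ (n : ℕ → ℕ) (m : ℕ), (∀ f ∈ A, ∀ g ∈ A, f < g → n f ≤ g) ∧ (∀ f ∈ A, q f ≤ n f) ∧
      (m ∈ A ∨ m = L) ∧ (∀ f ∈ A, m ≤ f) ∧
      ∀ x : E, ∑ f ∈ A, cut b K f (n f) x = cut b K m L x := by
  classical
  induction A using Finset.induction_on_min with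
  | empty => exact ⟨id, L, by simp, by simp, Or.inr rfl, by simp, by simp [cut_of_le]⟩
  | insert a s ha ih =>
    have has : a ∉ s := fun h => lt_irrefl _ (ha a h)
    obtain ⟨n, m, h1, h2, h3, h4, h5⟩ := ih
      (fun f hf g hg => hq f (Finset.mem_insert_of_mem hf) g (Finset.mem_insert_of_mem hg))
      (fun f hf => hL f (Finset.mem_insert_of_mem hf))
    have hn : ∀ f ∈ s, Function.update n a m f = n f := fun f hf =>
      Function.update_of_ne (by rintro rfl; exact has hf) _ _
    have hLa := hL a (Finset.mem_insert_self _ _)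
    have hmL : m ≤ L := by
      rcases h3 with h | h
      · exact (hL m (Finset.mem_insert_of_mem h)).1
      · exact h.le
    have ham : a ≤ m := by
      rcases h3 with h | h
      · exact (ha m h).le
      · exact h ▸ hLa.1
    refine ⟨Function.update n a m, a, ?_, ?_, Or.inl (Finset.mem_insert_self _ _), ?_, ?_⟩
    · intro f hf g hg hfg
      rcases Finset.mem_insert.1 hf with rfl | hf
      · rcases Finset.mem_insert.1 hg with rfl | hg
        · exact absurd hfg (lt_irrefl _)
        · rw [Function.update_self]
          exact h4 g hg
      · rw [hn f hf]
        rcases Finset.mem_insert.1 hg with hga | hg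
        · exact absurd (ha f hf) (not_lt.2 (hga ▸ hfg.le))
        · exact h1 f hf g hg hfg
    · intro f hf
      rcases Finset.mem_insert.1 hf with rfl | hf
      · rw [Function.update_self]
        rcases h3 with h | h
        · exact hq f (Finset.mem_insert_self _ _) m (Finset.mem_insert_of_mem h) (ha m h)
        · exact h ▸ hLa.2
      · rw [hn f hf]
        exact h2 f hf
    · intro f hf
      rcases Finset.mem_insert.1 hf with rfl | hf
      · exact le_rfl
      · exact (ha f hf).le
    · intro x
      rw [Finset.sum_insert has, Function.update_self,
        Finset.sum_congr rfl fun f hf => by rw [hn f hf], h5, cut_add ham hmL]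

/-- One factor `B` cuts the prolonged intervals back to the given ones, the other bounds the single
projection to which the prolonged pieces add up; `1 / δ` is the lower estimate. -/
theorem cutSum_le {B δ : ℝ} (hB : 0 < B) (hBc : ∀ (p q : ℕ) (x : E), ‖cut b K p q x‖ ≤ B * ‖x‖)
    {F : Set (Finset ℕ)} (hδ : 0 < δ) (hF : LowerEstimate F (tail b K) δ)
    (P : IntervalFamily F) (x : E) : cutSum b K P.1.1 P.1.2 x ≤ B * B / δ * ‖x‖ := by
  obtain ⟨⟨A, q⟩, hA, hq⟩ := P
  dsimp only at hA hq ⊢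
  obtain ⟨n, m, h1, h2, -, -, h5⟩ := exists_next (b := b) (K := K) A q hq (A.sup fun f => f + q f)
    fun f hf => by
      have := Finset.le_sup (f := fun f => f + q f) hf
      constructor <;> omega
  choose v hv1 hv2 using fun f => exists_cut_eq_comb (b := b) (K := K) f (n f) x
  have key := hF A hA v (fun f _ s hs => (hv1 f s hs).1) fun f hf g hg hfg s hs t ht =>
    ((hv1 f s hs).2.trans_le (h1 f hf g hg hfg)).trans_le (hv1 g t ht).1
  simp only [← hv2] at key
  rw [h5] at key
  rw [cutSum_apply]
  have h6 : ∑ f ∈ A, ‖cut b K f (q f) x‖ ≤ B * ∑ f ∈ A, ‖cut b K f (n f) x‖ := by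
    rw [Finset.mul_sum]
    refine Finset.sum_le_sum fun f hf => ?_
    rw [← cut_cut le_rfl (h2 f hf) x]
    exact hBc _ _ _
  have h7 := key.trans (hBc _ _ _)
  have h8 : ∑ f ∈ A, ‖cut b K f (n f) x‖ ≤ B * ‖x‖ / δ := by
    rw [le_div_iff₀ hδ, mul_comm]
    exact h7
  calc _ ≤ _ := h6
    _ ≤ B * (B * ‖x‖ / δ) := mul_le_mul_of_nonneg_left h8 hB.le
    _ = B * B / δ * ‖x‖ := by ring

theorem bddAbove_cutSum {B δ : ℝ} (hB : 0 < B)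
    (hBc : ∀ (p q : ℕ) (x : E), ‖cut b K p q x‖ ≤ B * ‖x‖)
    {F : Set (Finset ℕ)} (hδ : 0 < δ) (hF : LowerEstimate F (tail b K) δ) :
    BddAbove (Set.range fun P : IntervalFamily F => cutSum b K P.1.1 P.1.2) := by
  rw [Seminorm.bddAbove_range_iff]
  intro x
  refine ⟨B * B / δ * ‖x‖, ?_⟩
  rintro _ ⟨P, rfl⟩
  exact cutSum_le hB hBc hδ hF P x

theorem familySeminorm_le {B δ : ℝ} (hB : 0 < B)
    (hBc : ∀ (p q : ℕ) (x : E), ‖cut b K p q x‖ ≤ B * ‖x‖)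
    {F : Set (Finset ℕ)} (hδ : 0 < δ) (hF : LowerEstimate F (tail b K) δ) (x : E) :
    familySeminorm b K F x ≤ B * B / δ * ‖x‖ := by
  rw [familySeminorm, Seminorm.iSup_apply (bddAbove_cutSum hB hBc hδ hF)]
  exact Real.iSup_le (fun P => cutSum_le hB hBc hδ hF P x) (by positivity)

theorem cutSum_le_familySeminorm {F : Set (Finset ℕ)}
    (hF : BddAbove (Set.range fun P : IntervalFamily F => cutSum b K P.1.1 P.1.2))
    {A : Finset ℕ} {q : ℕ → ℕ} (hA : A ∈ F) (hq : ∀ f ∈ A, ∀ g ∈ A, f < g → q f ≤ g) (x : E) :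
    ∑ f ∈ A, ‖cut b K f (q f) x‖ ≤ familySeminorm b K F x := by
  rw [familySeminorm, Seminorm.iSup_apply hF, ← cutSum_apply]
  exact le_ciSup (f := fun P : IntervalFamily F => cutSum b K P.1.1 P.1.2 x)
    (Seminorm.bddAbove_range_iff.1 hF x) ⟨(A, q), hA, hq⟩

theorem norm_cut_le_familySeminorm {F : Set (Finset ℕ)}
    (hF : BddAbove (Set.range fun P : IntervalFamily F => cutSum b K P.1.1 P.1.2))
    {p : ℕ} (hp : {p} ∈ F) (q : ℕ) (x : E) :
    ‖cut b K p q x‖ ≤ familySeminorm b K F x := by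
  have := cutSum_le_familySeminorm hF (q := fun _ => q) hp
    (fun f hf g hg hfg => absurd hfg (by
      rw [Finset.mem_singleton.1 hf, Finset.mem_singleton.1 hg]; exact lt_irrefl _)) x
  rwa [Finset.sum_singleton] at this

/-- Intervals missing `[lo, hi)` are dropped and the others intersected with it. The left ends `f`
become `max f lo`, which stay distinct because a retained interval ends beyond `lo`. -/
theorem exists_trim {G : Set (Finset ℕ)} (hG : IsSpreading G) {A : Finset ℕ} (hA : A ∈ G)
    {q : ℕ → ℕ} (hq : ∀ f ∈ A, ∀ g ∈ A, f < g → q f ≤ g) {v : ℕ →₀ ℝ} {lo hi : ℕ}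
    (hv : ∀ s ∈ v.support, lo ≤ s ∧ s < hi) :
    ∃ (A' : Finset ℕ) (q' : ℕ → ℕ), A' ∈ G ∧ (∀ f ∈ A', ∀ g ∈ A', f < g → q' f ≤ g) ∧
      (∀ f ∈ A', lo ≤ f ∧ f < hi ∧ q' f ≤ hi) ∧
      ∑ f ∈ A, ‖cut b K f (q f) (comb (tail b K) v)‖ =
        ∑ f ∈ A', ‖cut b K f (q' f) (comb (tail b K) v)‖ := by
  classical
  rcases eq_or_ne v 0 with rfl | hv0
  · exact ⟨∅, id, hG.subset hA (Finset.empty_subset _), by simp, by simp, by simp [comb_zero]⟩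
  have hlohi : lo < hi := by
    obtain ⟨s, hs⟩ := Finsupp.support_nonempty_iff.2 hv0
    exact (hv s hs).1.trans_lt (hv s hs).2
  let A₁ := A.filter fun f => f < hi ∧ lo < q f
  have hA₁ : ∀ f ∈ A₁, f ∈ A ∧ f < hi ∧ lo < q f := fun f hf => Finset.mem_filter.1 hf
  have hmono : StrictMonoOn (fun f => max f lo) (A₁ : Set ℕ) := by
    intro f hf g hg hfg
    have h1 := hq f (hA₁ f hf).1 g (hA₁ g hg).1 hfg
    have h2 := (hA₁ f hf).2.2
    dsimp only
    omega
  have inv : ∀ f ∈ A₁, Function.invFunOn (fun f => max f lo) (A₁ : Set ℕ) (max f lo) = f :=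
    fun f hf => hmono.injOn.leftInvOn_invFunOn hf
  refine ⟨A₁.image fun f => max f lo,
    fun m => min hi (q (Function.invFunOn (fun f => max f lo) (A₁ : Set ℕ) m)), ?_, ?_, ?_, ?_⟩
  · refine hG.image (f := id) (strictMono_id.strictMonoOn _) hmono
      (fun f _ => le_max_left _ _) ?_
    rw [Finset.image_id]
    exact hG.subset hA (Finset.filter_subset _ _)
  · intro x hx y hy hxy
    obtain ⟨f, hf, rfl⟩ := Finset.mem_image.1 hx
    obtain ⟨g, hg, rfl⟩ := Finset.mem_image.1 hy
    simp only [inv f hf]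
    have h1 := hq f (hA₁ f hf).1 g (hA₁ g hg).1 ((hmono.lt_iff_lt hf hg).1 hxy)
    omega
  · intro x hx
    obtain ⟨f, hf, rfl⟩ := Finset.mem_image.1 hx
    have := (hA₁ f hf).2.1
    exact ⟨le_max_right _ _, by omega, min_le_left _ _⟩
  · rw [Finset.sum_image hmono.injOn]
    have : ∑ f ∈ A₁, ‖cut b K f (q f) (comb (tail b K) v)‖ =
        ∑ f ∈ A, ‖cut b K f (q f) (comb (tail b K) v)‖ := by
      refine Finset.sum_filter_of_ne fun f _ hne => ?_
      by_contra hcon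
      apply hne
      rw [cut_comb, (Finsupp.filter_eq_zero_iff _ _).2, comb_zero, norm_zero]
      intro s hs
      by_contra h0
      have := hv s (Finsupp.mem_support_iff.2 h0)
      omega
    rw [← this]
    refine Finset.sum_congr rfl fun f hf => ?_
    simp only [inv f hf]
    rw [cut_comb, cut_comb]
    congr 2
    ext s
    rw [Finsupp.filter_apply, Finsupp.filter_apply]
    by_cases h0 : v s = 0
    · simp [h0]
    · have := hv s (Finsupp.mem_support_iff.2 h0)
      have hiff : (f ≤ s ∧ s < q f) ↔ (max f lo ≤ s ∧ s < min hi (q f)) := by omega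
      simp only [hiff]

theorem sum_ciSup_le {ι κ : Type*} [Nonempty κ] (A : Finset ι) (f : ι → κ → ℝ) {R : ℝ}
    (h : ∀ P : ι → κ, ∑ j ∈ A, f j (P j) ≤ R) : ∑ j ∈ A, ⨆ k, f j k ≤ R := by
  refine le_of_forall_pos_le_add fun η hη => ?_
  have hη' : 0 < η / (A.card + 1) := by positivity
  choose P hP using fun j => exists_lt_of_lt_ciSup (sub_lt_self (⨆ k, f j k) hη')
  have h1 : ∑ j ∈ A, ⨆ k, f j k ≤ ∑ j ∈ A, (f j (P j) + η / (A.card + 1)) :=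
    Finset.sum_le_sum fun j _ => by linarith [hP j]
  rw [Finset.sum_add_distrib, Finset.sum_const, nsmul_eq_mul] at h1
  have h2 : (A.card : ℝ) * (η / (A.card + 1)) ≤ η := by
    rw [mul_div_assoc', div_le_iff₀ (by positivity)]
    nlinarith
  linarith [h P]

/-- Choose an interval family for each `v_j`, trim it to the range of `v_j`, and take the union. Its
left ends form a set in `H[G]`, so the union competes in the supremum for `F`. -/
theorem sum_familySeminorm_le {F G H : Set (Finset ℕ)} (hG : IsSpreading G) (hG0 : ∅ ∈ G)
    (hH : IsSpreading H) (hsub : familyComp H G ⊆ F)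
    (hGb : BddAbove (Set.range fun P : IntervalFamily G => cutSum b K P.1.1 P.1.2))
    (hFb : BddAbove (Set.range fun P : IntervalFamily F => cutSum b K P.1.1 P.1.2))
    {A : Finset ℕ} (hA : A ∈ H) {v : ℕ → ℕ →₀ ℝ} (hle : ∀ i ∈ A, ∀ s ∈ (v i).support, i ≤ s)
    (hlt : ∀ i ∈ A, ∀ j ∈ A, i < j → ∀ s ∈ (v i).support, s < j) :
    ∑ j ∈ A, familySeminorm b K G (comb (tail b K) (v j)) ≤
      familySeminorm b K F (comb (tail b K) (∑ j ∈ A, v j)) := by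
  classical
  have : Nonempty (IntervalFamily G) := ⟨⟨(∅, id), hG0, by simp⟩⟩
  simp only [familySeminorm, Seminorm.iSup_apply hGb]
  refine sum_ciSup_le A _ fun P => ?_
  rw [← familySeminorm]
  let hi : ℕ → ℕ := fun j => (v j).support.sup id + 1
  have hhi : ∀ j, ∀ s ∈ (v j).support, s < hi j := fun j s hs =>
    Nat.lt_succ_of_le (Finset.le_sup (f := id) hs)
  have hhile : ∀ i ∈ A, ∀ j ∈ A, i < j → hi i ≤ j := by
    intro i hi' j hj hij
    refine Nat.succ_le_of_lt ?_
    rw [Finset.sup_lt_iff ((Nat.zero_le i).trans_lt hij)]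
    exact hlt i hi' j hj hij
  have htrim : ∀ j, ∃ (A' : Finset ℕ) (q' : ℕ → ℕ), j ∈ A →
      A' ∈ G ∧ (∀ f ∈ A', ∀ g ∈ A', f < g → q' f ≤ g) ∧
      (∀ f ∈ A', j ≤ f ∧ f < hi j ∧ q' f ≤ hi j) ∧
      ∑ f ∈ (P j).1.1, ‖cut b K f ((P j).1.2 f) (comb (tail b K) (v j))‖ =
        ∑ f ∈ A', ‖cut b K f (q' f) (comb (tail b K) (v j))‖ := by
    intro j
    by_cases hj : j ∈ A
    · obtain ⟨A', q', h⟩ := exists_trim (b := b) (K := K) hG (P j).2.1 (P j).2.2 (v := v j)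
        (lo := j) (hi := hi j) fun s hs => ⟨hle j hj s hs, hhi j s hs⟩
      exact ⟨A', q', fun _ => h⟩
    · exact ⟨∅, id, fun h => absurd h hj⟩
  choose A' q' htrim using htrim
  -- The largest element of `A` below `f`: it recovers the block whose range contains the left end
  -- `f`.
  let φ : ℕ → ℕ := fun f => (A.filter (· ≤ f)).sup id
  have hφ : ∀ j ∈ A, ∀ f ∈ A' j, φ f = j := by
    intro j hj f hf
    have hf' := (htrim j hj).2.2.1 f hf
    refine le_antisymm (Finset.sup_le fun i hi' => ?_)
      (Finset.le_sup (f := id) (Finset.mem_filter.2 ⟨hj, hf'.1⟩))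
    rw [Finset.mem_filter] at hi'
    by_contra hcon
    have := hhile j hj i hi'.1 (not_le.1 hcon)
    simp only [id] at hcon
    omega
  have hmemF : ∀ f ∈ A.biUnion A', ∃ j ∈ A, f ∈ A' j := fun f hf => Finset.mem_biUnion.1 hf
  have hfib : ∀ j ∈ A, (A.biUnion A').filter (fun f => φ f = j) = A' j := by
    intro j hj
    ext f
    rw [Finset.mem_filter, Finset.mem_biUnion]
    constructor
    · rintro ⟨⟨i, hi', hf⟩, h⟩
      rw [hφ i hi' f hf] at h
      exact h ▸ hf
    · intro hf
      exact ⟨⟨j, hj, hf⟩, hφ j hj f hf⟩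
  have himg : ∀ k ∈ (A.biUnion A').image φ, k ∈ A := by
    intro k hk
    obtain ⟨f, hf, rfl⟩ := Finset.mem_image.1 hk
    obtain ⟨j, hj, hf⟩ := hmemF f hf
    rwa [hφ j hj f hf]
  have hcomp : A.biUnion A' ∈ F := by
    refine hsub (mem_familyComp_of_coloring hH φ ?_ ?_ (hH.subset hA himg) ?_)
    · intro f _ g _ hfg
      exact Finset.sup_mono fun i hi' => by
        rw [Finset.mem_filter] at hi' ⊢
        exact ⟨hi'.1, hi'.2.trans hfg⟩
    · intro f _
      exact Finset.sup_le fun i hi' => (Finset.mem_filter.1 hi').2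
    · intro k hk
      rw [hfib k (himg k hk)]
      exact (htrim k (himg k hk)).1
  have hdis : ∀ f ∈ A.biUnion A', ∀ g ∈ A.biUnion A', f < g → q' (φ f) f ≤ g := by
    intro f hf g hg hfg
    obtain ⟨i, hi', hf⟩ := hmemF f hf
    obtain ⟨j, hj, hg⟩ := hmemF g hg
    rw [hφ i hi' f hf]
    have h1 := (htrim i hi').2.2.1 f hf
    have h2 := (htrim j hj).2.2.1 g hg
    rcases lt_trichotomy i j with hij | rfl | hij
    · exact h1.2.2.trans ((hhile i hi' j hj hij).trans h2.1)
    · exact (htrim i hi').2.1 f hf g hg hfg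
    · have := hhile j hj i hi' hij
      omega
  have hfin := cutSum_le_familySeminorm hFb (q := fun f => q' (φ f) f) hcomp hdis
    (comb (tail b K) (∑ j ∈ A, v j))
  refine le_trans (le_of_eq ?_) hfin
  rw [Finset.sum_biUnion]
  · refine Finset.sum_congr rfl fun j hj => ?_
    rw [cutSum_apply, (htrim j hj).2.2.2]
    refine Finset.sum_congr rfl fun f hf => ?_
    have h1 := (htrim j hj).2.2.1 f hf
    rw [hφ j hj f hf, comb_sum, map_sum, Finset.sum_eq_single j]
    · intro i hi' hij
      rw [cut_comb, (Finsupp.filter_eq_zero_iff _ _).2, comb_zero]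
      intro s hs
      by_contra h0
      have hs' := Finsupp.mem_support_iff.2 h0
      rcases lt_or_gt_of_ne hij with hij | hij
      · have := hlt i hi' j hj hij s hs'
        omega
      · have := hle i hi' s hs'
        have := hhile j hj i hi' hij
        omega
    · exact fun h => absurd hj h
  · intro i hi' j hj hij
    rw [Function.onFun, Finset.disjoint_left]
    intro f hf hf'
    exact hij ((hφ i hi' f hf).symm.trans (hφ j hj f hf'))

end Cut

/-! ### Renorming and distortion -/

section Renorming

variable {E : Type*} [NormedAddCommGroup E] [NormedSpace ℝ E] {b : SchauderBasis ℝ E} {K : ℕ}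

theorem norm_le_add_familySeminorm {F : Set (Finset ℕ)}
    (hF : BddAbove (Set.range fun P : IntervalFamily F => cutSum b K P.1.1 P.1.2))
    (h0 : {0} ∈ F) (x : E) : ‖x‖ ≤ ‖SchauderBasis.proj b K x‖ + familySeminorm b K F x := by
  have hlim : Tendsto (fun q => ‖SchauderBasis.proj b (K + q) x‖) atTop (𝓝 ‖x‖) :=
    ((SchauderBasis.tendsto_proj b x).comp (tendsto_add_atTop_nat K |>.congr fun q =>
      add_comm q K)).norm
  refine le_of_tendsto' hlim fun q => ?_
  rw [← proj_add_cut]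
  exact (norm_add_le _ _).trans (add_le_add le_rfl (norm_cut_le_familySeminorm hF h0 q x))

/-- An equivalent norm satisfying a lower `ℓ₁` estimate with constant `t`, obtained from a chain of
families `F 0, …, F N` with `H[F i] ⊆ F (i + 1)`. -/
theorem exists_seminorm_of_chain {B : ℝ} (hB : 0 < B)
    (hBc : ∀ (p q : ℕ) (x : E), ‖cut b K p q x‖ ≤ B * ‖x‖) {N : ℕ} (hN : N ≠ 0)
    {F : ℕ → Set (Finset ℕ)} {H : Set (Finset ℕ)} (hF : ∀ i, IsSpreading (F i))
    (hH : IsSpreading H) (hF0 : {0} ∈ F 0) (hFe : ∀ i, ∅ ∈ F i)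
    (hsub : ∀ i < N, familyComp H (F i) ⊆ F (i + 1))
    {δ : ℕ → ℝ} (hδ : ∀ i ≤ N, 0 < δ i) (hlow : ∀ i ≤ N, LowerEstimate (F i) (tail b K) (δ i))
    (t : ℝ≥0) (ht : (t : ℝ) ^ N * (B * B / δ N) ≤ 1) :
    ∃ (p : Seminorm ℝ E) (C : ℝ), (∀ x, ‖x‖ ≤ p x) ∧ (∀ x, p x ≤ C * ‖x‖) ∧
      ∀ A ∈ H, ∀ v : ℕ → ℕ →₀ ℝ, (∀ i ∈ A, ∀ s ∈ (v i).support, i ≤ s) →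
        (∀ i ∈ A, ∀ j ∈ A, i < j → ∀ s ∈ (v i).support, s < j) →
        t * ∑ j ∈ A, p (comb (tail b K) (v j)) ≤ p (∑ j ∈ A, comb (tail b K) (v j)) := by
  let f : ℕ → Seminorm ℝ E := fun i => familySeminorm b K (F i)
  -- The first summand controls the initial `K` coordinates and vanishes on the tail. The weights `t
  -- ^ i` turn multiplication by `t` into the index shift from `f i` to `f (i + 1)`.
  let p : Seminorm ℝ E := (normSeminorm ℝ E).comp (SchauderBasis.proj b K).toLinearMap +
    ∑ i ∈ Finset.range N, t ^ i • f i
  have hp : ∀ x, p x = ‖SchauderBasis.proj b K x‖ + ∑ i ∈ Finset.range N, (t : ℝ) ^ i * f i x := by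
    intro x
    simp only [p, add_apply, seminorm_sum_apply]
    congr 1
  have hbdd : ∀ i ≤ N, BddAbove (Set.range fun P : IntervalFamily (F i) =>
      cutSum b K P.1.1 P.1.2) := fun i hi => bddAbove_cutSum hB hBc (hδ i hi) (hlow i hi)
  have hnorm := norm_le_add_familySeminorm (hbdd 0 (Nat.zero_le _)) hF0
  refine ⟨p, ‖SchauderBasis.proj b K‖ + ∑ i ∈ Finset.range N, (t : ℝ) ^ i * (B * B / δ i),
    ?_, ?_, ?_⟩
  · intro x
    refine (hnorm x).trans ?_
    rw [hp]
    refine add_le_add le_rfl ?_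
    have := Finset.single_le_sum (f := fun i => (t : ℝ) ^ i * f i x)
      (fun i _ => mul_nonneg (by positivity) (apply_nonneg _ _))
      (Finset.mem_range.2 (Nat.pos_of_ne_zero hN))
    simpa using this
  · intro x
    rw [hp, add_mul, Finset.sum_mul]
    refine add_le_add (ContinuousLinearMap.le_opNorm _ _) (Finset.sum_le_sum fun i hi => ?_)
    have hi' := (Finset.mem_range.1 hi).le
    rw [mul_assoc]
    exact mul_le_mul_of_nonneg_left (familySeminorm_le hB hBc (hδ i hi') (hlow i hi') x)
      (by positivity)
  · intro A hA v hle hlt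
    rw [← comb_sum]
    set x := comb (tail b K) (∑ j ∈ A, v j) with hx
    have h1 : ∀ i < N, ∑ j ∈ A, f i (comb (tail b K) (v j)) ≤ f (i + 1) x := fun i hi =>
      sum_familySeminorm_le (hF i) (hFe i) hH (hsub i hi) (hbdd i hi.le) (hbdd (i + 1) hi) hA
        hle hlt
    have h2 : (t : ℝ) * ∑ j ∈ A, p (comb (tail b K) (v j)) =
        ∑ i ∈ Finset.range N, (t : ℝ) ^ (i + 1) * ∑ j ∈ A, f i (comb (tail b K) (v j)) := by
      simp only [hp, proj_comb_tail, norm_zero, zero_add]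
      rw [Finset.sum_comm, Finset.mul_sum]
      refine Finset.sum_congr rfl fun i _ => ?_
      rw [← Finset.mul_sum, pow_succ]
      ring
    have h3 : ∑ i ∈ Finset.range N, (t : ℝ) ^ (i + 1) * ∑ j ∈ A, f i (comb (tail b K) (v j)) ≤
        ∑ i ∈ Finset.range N, (t : ℝ) ^ (i + 1) * f (i + 1) x :=
      Finset.sum_le_sum fun i hi =>
        mul_le_mul_of_nonneg_left (h1 i (Finset.mem_range.1 hi)) (by positivity)
    have h4 := Finset.sum_range_succ' (fun i => (t : ℝ) ^ i * f i x) N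
    rw [Finset.sum_range_succ] at h4
    have h5 : ‖x‖ ≤ f 0 x := by simpa only [hx, proj_comb_tail, norm_zero, zero_add] using hnorm x
    have h6 : (t : ℝ) ^ N * f N x ≤ ‖x‖ := by
      calc (t : ℝ) ^ N * f N x ≤ (t : ℝ) ^ N * (B * B / δ N * ‖x‖) :=
            mul_le_mul_of_nonneg_left
              (familySeminorm_le hB hBc (hδ N le_rfl) (hlow N le_rfl) x) (by positivity)
        _ = (t : ℝ) ^ N * (B * B / δ N) * ‖x‖ := by ring
        _ ≤ 1 * ‖x‖ := mul_le_mul_of_nonneg_right ht (norm_nonneg _)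
        _ = ‖x‖ := one_mul _
    have h7 : p x = ∑ i ∈ Finset.range N, (t : ℝ) ^ i * f i x := by
      rw [hp, hx, proj_comb_tail, norm_zero, zero_add]
    simp only [pow_zero, one_mul] at h4
    rw [h2, h7]
    linarith

end Renorming

/-! ### Block sequences close to a given subspace -/

section GlidingHump

variable {E : Type*} [NormedAddCommGroup E] [NormedSpace ℝ E] {b : SchauderBasis ℝ E} {K : ℕ}

theorem exists_mem_ne_zero_proj_eq_zero (b : SchauderBasis ℝ E) {W : Submodule ℝ E}
    (hW : ¬ FiniteDimensional ℝ W) (m : ℕ) :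
    ∃ x ∈ W, x ≠ 0 ∧ SchauderBasis.proj b m x = 0 := by
  by_contra! hcon
  apply hW
  have hfin : FiniteDimensional ℝ (SchauderBasis.proj b m).toLinearMap.range := by
    rw [SchauderBasis.range_proj_eq_span]
    exact FiniteDimensional.span_of_finite ℝ ((Finset.finite_toSet _).image _)
  refine FiniteDimensional.of_injective
    ((SchauderBasis.proj b m).toLinearMap.rangeRestrict.comp W.subtype) ?_
  rw [← LinearMap.ker_eq_bot, LinearMap.ker_eq_bot']
  intro x hx
  by_contra hne
  exact hcon x x.2 (fun h => hne (Subtype.ext h)) (congrArg Subtype.val hx)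

theorem exists_near_tail (b : SchauderBasis ℝ E) (K : ℕ) {W : Submodule ℝ E}
    (hW : ¬ FiniteDimensional ℝ W) (m : ℕ) {ε : ℝ} (hε : 0 < ε) :
    ∃ x ∈ W, ∃ a : ℕ →₀ ℝ, (∀ s ∈ a.support, m ≤ s) ∧ 1 ≤ ‖comb (tail b K) a‖ ∧
      ‖x - comb (tail b K) a‖ ≤ ε := by
  obtain ⟨x, hxW, hx0, hx⟩ := exists_mem_ne_zero_proj_eq_zero b hW (K + m)
  have hpos : 0 < ‖x‖ := norm_pos_iff.2 hx0
  -- Norm 2 leaves room for a truncation error below 1, so the truncated vector still has norm at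
  -- least 1.
  set z : E := (2 / ‖x‖) • x with hz
  have hzn : ‖z‖ = 2 := by
    rw [hz, norm_smul, norm_div, norm_norm, Real.norm_two, div_mul_cancel₀ _ hpos.ne']
  have hz0 : SchauderBasis.proj b (K + m) z = 0 := by rw [hz, map_smul, hx, smul_zero]
  have hlim : Tendsto (fun q => cut b K m q z) atTop (𝓝 z) := by
    have : Tendsto (fun q => SchauderBasis.proj b (K + q) z) atTop (𝓝 z) :=
      (SchauderBasis.tendsto_proj b z).comp (tendsto_add_atTop_nat K |>.congr fun q =>
        add_comm q K)
    refine this.congr' ?_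
    filter_upwards [eventually_ge_atTop m] with q hq
    rw [cut_eq_sub hq, hz0, sub_zero]
  obtain ⟨q, hq⟩ := (Metric.tendsto_nhds.1 hlim (min ε 1) (lt_min hε one_pos)).exists
  rw [dist_eq_norm, norm_sub_rev] at hq
  obtain ⟨a, ha, hca⟩ := exists_cut_eq_comb (b := b) (K := K) m q z
  rw [hca] at hq
  refine ⟨z, W.smul_mem _ hxW, a, fun s hs => (ha s hs).1, ?_, (hq.trans_le (min_le_left _ _)).le⟩
  have h1 := norm_sub_norm_le z (comb (tail b K) a)
  have h2 := hq.trans_le (min_le_right _ _)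
  linarith

theorem exists_block_near (b : SchauderBasis ℝ E) (K : ℕ) {W : Submodule ℝ E}
    (hW : ¬ FiniteDimensional ℝ W) (M : ℕ → ℕ) {η : ℕ → ℝ} (hη : ∀ j, 0 < η j) :
    ∃ (x : ℕ → E) (a : ℕ → ℕ →₀ ℝ), IsSuccessive a ∧ (∀ j, x j ∈ W) ∧
      (∀ j, ∀ s ∈ (a j).support, M j ≤ s) ∧ (∀ j, 1 ≤ ‖comb (tail b K) (a j)‖) ∧
      ∀ j, ‖x j - comb (tail b K) (a j)‖ ≤ η j := by
  choose X hXW A hA hA1 hXA using fun j m => exists_near_tail b K hW m (hη j)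
  let st : ℕ → ℕ := fun j => Nat.rec (M 0)
    (fun j m => max (M (j + 1)) ((A j m).support.sup id + 1)) j
  have hst : ∀ j, st (j + 1) = max (M (j + 1)) ((A j (st j)).support.sup id + 1) := fun j => rfl
  have hM : ∀ j, M j ≤ st j := by
    intro j
    cases j with
    | zero => exact le_rfl
    | succ j => exact (le_max_left _ _).trans (hst j).ge
  have hlt : ∀ j, ∀ s ∈ (A j (st j)).support, s < st (j + 1) := fun j s hs =>
    (Nat.lt_succ_of_le (Finset.le_sup (f := id) hs)).trans_le ((le_max_right _ _).trans (hst j).ge)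
  have hne : ∀ j, A j (st j) ≠ 0 := by
    intro j h0
    have := hA1 j (st j)
    rw [h0, comb_zero, norm_zero] at this
    linarith
  have hmono : Monotone st := monotone_nat_of_le_succ fun j => by
    obtain ⟨s, hs⟩ := Finsupp.support_nonempty_iff.2 (hne j)
    exact (hA j _ s hs).trans (hlt j s hs).le
  refine ⟨fun j => X j (st j), fun j => A j (st j), ⟨hne, fun i j hij s hs t ht => ?_⟩,
    fun j => hXW _ _, fun j s hs => (hM j).trans (hA _ _ s hs), fun j => hA1 _ _,
    fun j => hXA _ _⟩
  exact (hlt i s hs).trans_le ((hmono hij).trans (hA _ _ t ht))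

theorem IsSuccessive.linearCombination_apply {a : ℕ → ℕ →₀ ℝ} (h : IsSuccessive a)
    (d : ℕ →₀ ℝ) {j s : ℕ} (h1 : minSupp (a j) ≤ s) (h2 : s ≤ (a j).support.sup id) :
    Finsupp.linearCombination ℝ a d s = d j * a j s := by
  have hsup : (a j).support.sup id ∈ (a j).support :=
    Finset.sup_mem_of_nonempty (Finsupp.support_nonempty_iff.2 (h.1 j)) |>.elim
      fun t ht => ht.2 ▸ ht.1
  rw [Finsupp.linearCombination_apply, Finsupp.sum, Finsupp.finsetSum_apply,
    Finset.sum_eq_single j]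
  · rfl
  · intro i _ hij
    rw [Finsupp.smul_apply]
    have : a i s = 0 := by
      by_contra h0
      have hs := Finsupp.mem_support_iff.2 h0
      rcases lt_or_gt_of_ne hij with hij | hij
      · exact absurd (h.2 i j hij s hs _ (minSupp_mem (h.1 j))) (not_lt.2 h1)
      · exact absurd (h.2 j i hij _ hsup s hs) (not_lt.2 h2)
    rw [this, smul_zero]
  · intro hj
    rw [Finsupp.notMem_support_iff.1 hj, zero_smul]
    rfl

theorem exists_mem_of_mem_support_linearCombination {a : ℕ → ℕ →₀ ℝ} {d : ℕ →₀ ℝ} {s : ℕ}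
    (hs : s ∈ (Finsupp.linearCombination ℝ a d).support) :
    ∃ j ∈ d.support, s ∈ (a j).support := by
  classical
  rw [Finsupp.linearCombination_apply, Finsupp.sum] at hs
  obtain ⟨j, hj, hs⟩ := Finset.mem_biUnion.1 (Finsupp.support_finsetSum hs)
  exact ⟨j, hj, Finsupp.support_smul hs⟩

theorem IsSuccessive.linearCombination {ι : Type*} [LT ι] {a : ℕ → ℕ →₀ ℝ} (h : IsSuccessive a)
    {d : ι → ℕ →₀ ℝ} (hd : IsSuccessive d) :
    IsSuccessive fun i => Finsupp.linearCombination ℝ a (d i) := by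
  refine ⟨fun i h0 => ?_, fun i j hij s hs t ht => ?_⟩
  · obtain ⟨l, hl⟩ := Finsupp.support_nonempty_iff.2 (hd.1 i)
    have hm := minSupp_mem (h.1 l)
    have := h.linearCombination_apply (d i) le_rfl (Finset.le_sup (f := id) hm)
    rw [show Finsupp.linearCombination ℝ a (d i) = 0 from h0, Finsupp.zero_apply] at this
    exact mul_ne_zero (Finsupp.mem_support_iff.1 hl) (Finsupp.mem_support_iff.1 hm) this.symm
  · obtain ⟨l, hl, hs⟩ := exists_mem_of_mem_support_linearCombination hs
    obtain ⟨l', hl', ht⟩ := exists_mem_of_mem_support_linearCombination ht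
    exact h.2 l l' (hd.2 i j hij l hl l' hl') s hs t ht

theorem comb_block (x : ℕ → E) (a : ℕ → ℕ →₀ ℝ) (d : ℕ →₀ ℝ) :
    comb (fun j => comb x (a j)) d = comb x (Finsupp.linearCombination ℝ a d) := by
  simp only [comb, Finsupp.linearCombination_apply ℝ d, Finsupp.sum, map_sum, map_smul]

theorem abs_coeff_mul_norm_le {B : ℝ} (hBc : ∀ (p q : ℕ) (x : E), ‖cut b K p q x‖ ≤ B * ‖x‖)
    {a : ℕ → ℕ →₀ ℝ} (h : IsSuccessive a) (d : ℕ →₀ ℝ) (j : ℕ) :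
    |d j| * ‖comb (tail b K) (a j)‖ ≤
      B * ‖comb (fun j => comb (tail b K) (a j)) d‖ := by
  have hcut : cut b K (minSupp (a j)) ((a j).support.sup id + 1)
      (comb (fun j => comb (tail b K) (a j)) d) = d j • comb (tail b K) (a j) := by
    rw [comb_block, cut_comb]
    have : d j • comb (tail b K) (a j) = comb (tail b K) (d j • a j) := (map_smul _ _ _).symm
    rw [this]
    congr 1
    ext s
    rw [Finsupp.filter_apply, Finsupp.smul_apply, smul_eq_mul]
    split_ifs with hs
    · exact h.linearCombination_apply d hs.1 (Nat.lt_succ_iff.1 hs.2)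
    · by_contra h0
      have hs' := Finsupp.mem_support_iff.2 (right_ne_zero_of_mul (Ne.symm h0))
      exact hs ⟨minSupp_le hs', Nat.lt_succ_of_le (Finset.le_sup (f := id) hs')⟩
  rw [← Real.norm_eq_abs, ← norm_smul, ← hcut]
  exact hBc _ _ _

/-- Interval projections bound each coefficient by `B` times the norm of the combination, and the
errors are summable with total `ρ / B`. Hence the perturbation is relatively small uniformly in `d`.
-/
theorem norm_comb_sub_comb_le {B ρ : ℝ} (hB : 0 < B) (hρ : 0 ≤ ρ)
    (hBc : ∀ (p q : ℕ) (x : E), ‖cut b K p q x‖ ≤ B * ‖x‖) {a : ℕ → ℕ →₀ ℝ}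
    (h : IsSuccessive a) (h1 : ∀ j, 1 ≤ ‖comb (tail b K) (a j)‖) {x : ℕ → E}
    (hx : ∀ j, ‖x j - comb (tail b K) (a j)‖ ≤ ρ / B * (1 / 2 / 2 ^ j)) (d : ℕ →₀ ℝ) :
    ‖comb x d - comb (fun j => comb (tail b K) (a j)) d‖ ≤
      ρ * ‖comb (fun j => comb (tail b K) (a j)) d‖ := by
  set V := comb (fun j => comb (tail b K) (a j)) d with hV
  have hd : ∀ j, |d j| ≤ B * ‖V‖ := fun j =>
    (le_mul_of_one_le_right (abs_nonneg _) (h1 j)).trans (abs_coeff_mul_norm_le hBc h d j)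
  have heq : comb x d - V = ∑ j ∈ d.support, d j • (x j - comb (tail b K) (a j)) := by
    rw [hV, comb, comb, Finsupp.linearCombination_apply, Finsupp.linearCombination_apply,
      Finsupp.sum, Finsupp.sum, ← Finset.sum_sub_distrib]
    simp only [smul_sub]
  have hgeo : ∑ j ∈ d.support, (1 : ℝ) / 2 / 2 ^ j ≤ 1 := by
    have := (summable_geometric_two' (1 : ℝ)).sum_le_tsum d.support fun j _ => by positivity
    rwa [tsum_geometric_two'] at this
  rw [heq]
  calc ‖∑ j ∈ d.support, d j • (x j - comb (tail b K) (a j))‖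
      ≤ ∑ j ∈ d.support, ‖d j • (x j - comb (tail b K) (a j))‖ := norm_sum_le _ _
    _ ≤ ∑ j ∈ d.support, ρ * ‖V‖ * (1 / 2 / 2 ^ j) := by
        refine Finset.sum_le_sum fun j _ => ?_
        rw [norm_smul, Real.norm_eq_abs]
        calc |d j| * ‖x j - comb (tail b K) (a j)‖
            ≤ (B * ‖V‖) * (ρ / B * (1 / 2 / 2 ^ j)) :=
              mul_le_mul (hd j) (hx j) (norm_nonneg _) (by positivity)
          _ = ρ * ‖V‖ * (1 / 2 / 2 ^ j) := by field_simp
    _ = ρ * ‖V‖ * ∑ j ∈ d.support, (1 : ℝ) / 2 / 2 ^ j := by rw [Finset.mul_sum]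
    _ ≤ ρ * ‖V‖ * 1 := mul_le_mul_of_nonneg_left hgeo (by positivity)
    _ = ρ * ‖V‖ := mul_one _

end GlidingHump

/-! ### Oscillation of the new norm and arbitrary distortion -/

section Distortion

variable {E : Type*} [NormedAddCommGroup E] [NormedSpace ℝ E] {b : SchauderBasis ℝ E} {K : ℕ}

theorem basis_ne_zero (b : SchauderBasis ℝ E) (i : ℕ) : b i ≠ 0 :=
  (GeneralSchauderBasis.linearIndependent b).ne_zero i

/-- A norm `p ≥ ‖·‖` with a lower `ℓ₁` estimate with constant `t` for `F`-admissible blocks has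
large oscillation on `W` if `‖·‖` has no lower `ℓ₁` estimate with constant `2 g` for the
`F`-admissible blocks of any block basis. -/
theorem le_of_oscillation_le {B : ℝ} (hB : 0 < B)
    (hBc : ∀ (p q : ℕ) (x : E), ‖cut b K p q x‖ ≤ B * ‖x‖) {F : Set (Finset ℕ)}
    (hF0 : {0} ∈ F) {M : ℕ → ℕ} {g : ℝ}
    (hg : ∀ w : ℕ → E, IsBlockBasis w (tail b K) → deltaConst F w < 2 * g)
    {p : Seminorm ℝ E} {C t : ℝ} (ht : 0 < t) (hp1 : ∀ x, ‖x‖ ≤ p x) (hpC : ∀ x, p x ≤ C * ‖x‖)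
    (hp : ∀ A ∈ sparseFamily M F, ∀ v : ℕ → ℕ →₀ ℝ, (∀ i ∈ A, ∀ s ∈ (v i).support, i ≤ s) →
        (∀ i ∈ A, ∀ j ∈ A, i < j → ∀ s ∈ (v i).support, s < j) →
        t * ∑ j ∈ A, p (comb (tail b K) (v j)) ≤ p (∑ j ∈ A, comb (tail b K) (v j)))
    {W : Submodule ℝ E} (hW : ¬ FiniteDimensional ℝ W) {D : ℝ} (hD : 0 ≤ D)
    (hWD : ∀ x ∈ W, ∀ y ∈ W, p x * ‖y‖ ≤ D * (p y * ‖x‖)) : t / (6 * g) ≤ D := by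
  classical
  set C' := max C 1 with hC'
  have hC'1 : 1 ≤ C' := le_max_right _ _
  have hpC' : ∀ x, p x ≤ C' * ‖x‖ := fun x =>
    (hpC x).trans (mul_le_mul_of_nonneg_right (le_max_left _ _) (norm_nonneg _))
  -- Chosen so that the relative perturbation is at most `1 / 4` in `p` as well as in the original
  -- norm.
  obtain ⟨ρ, hρ⟩ : ∃ ρ, ρ = 1 / (4 * C') := ⟨_, rfl⟩
  have hρ0 : 0 < ρ := by rw [hρ]; positivity
  have hρC : C' * ρ = 1 / 4 := by rw [hρ]; field_simp
  have hρ4 : ρ ≤ 1 / 4 := by nlinarith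
  obtain ⟨x, a, ha, hxW, haM, ha1, hxa⟩ := exists_block_near b K hW M
    (η := fun j => ρ / B * (1 / 2 / 2 ^ j)) fun j => by positivity
  set w : ℕ → E := fun j => comb (tail b K) (a j) with hw
  have hblock : IsBlockBasis w (tail b K) := ⟨a, ha, fun j => rfl⟩
  have hw0 : w 0 ≠ 0 := fun h => by
    have := ha1 0
    rw [show comb (tail b K) (a 0) = 0 from h, norm_zero] at this
    linarith
  obtain ⟨k, d, hd, hdF, hdlt⟩ := exists_lt_of_deltaConst_lt hF0 hw0 (hg w hblock)
  have happrox : ∀ f : ℕ →₀ ℝ, comb x f ∈ W ∧ 3 / 4 * ‖comb w f‖ ≤ ‖comb x f‖ ∧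
      ‖comb x f‖ ≤ 5 / 4 * ‖comb w f‖ ∧ 3 / 4 * p (comb w f) ≤ p (comb x f) ∧
      p (comb x f) ≤ 5 / 4 * p (comb w f) := by
    intro f
    have h1 := norm_comb_sub_comb_le hB hρ0.le hBc ha ha1 hxa f
    rw [← hw] at h1
    have h2 : ‖comb x f - comb w f‖ ≤ 1 / 4 * ‖comb w f‖ :=
      h1.trans (mul_le_mul_of_nonneg_right hρ4 (norm_nonneg _))
    have h3 : p (comb x f - comb w f) ≤ 1 / 4 * p (comb w f) := by
      calc p (comb x f - comb w f) ≤ C' * ‖comb x f - comb w f‖ := hpC' _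
        _ ≤ C' * (ρ * ‖comb w f‖) := mul_le_mul_of_nonneg_left h1 (by linarith)
        _ = 1 / 4 * ‖comb w f‖ := by rw [← mul_assoc, hρC]
        _ ≤ 1 / 4 * p (comb w f) := mul_le_mul_of_nonneg_left (hp1 _) (by norm_num)
    have h4 := norm_sub_norm_le (comb x f) (comb w f)
    have h5 := norm_sub_norm_le (comb w f) (comb x f)
    have h6 : p (comb x f) ≤ p (comb x f - comb w f) + p (comb w f) := by
      simpa using map_add_le_add p (comb x f - comb w f) (comb w f)
    have h7 : p (comb w f) ≤ p (comb x f - comb w f) + p (comb x f) := by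
      have := map_add_le_add p (comb w f - comb x f) (comb x f)
      rwa [sub_add_cancel, map_sub_rev] at this
    rw [norm_sub_rev] at h5
    refine ⟨?_, by linarith, by linarith, by linarith, by linarith⟩
    rw [comb, Finsupp.linearCombination_apply, Finsupp.sum]
    exact W.sum_mem fun j _ => W.smul_mem _ (hxW j)
  have he := ha.linearCombination hd
  obtain ⟨v, hv, hv1, hv2⟩ := he.exists_reindex
  -- Since `w j` is supported beyond `M j`, a block of `w` starting at index `m` starts beyond `M m`
  -- in the tail. Admissibility with respect to `w` thus becomes sparse admissibility with respect
  -- to the tail.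
  have hmem : (Finset.univ.image fun i => minSupp (Finsupp.linearCombination ℝ a (d i))) ∈
      sparseFamily M F := by
    have hinj := he.strictMono_minSupp.injective
    have hext : ∀ i, Function.extend (fun i => minSupp (Finsupp.linearCombination ℝ a (d i)))
        (fun i => minSupp (d i)) 0 (minSupp (Finsupp.linearCombination ℝ a (d i))) =
        minSupp (d i) := fun i => hinj.extend_apply (fun i => minSupp (d i)) 0 i
    refine ⟨Function.extend (fun i => minSupp (Finsupp.linearCombination ℝ a (d i)))
        (fun i => minSupp (d i)) 0, ?_, ?_, ?_⟩
    · intro m hm m' hm' hlt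
      obtain ⟨i, -, rfl⟩ := Finset.mem_image.1 hm
      obtain ⟨j, -, rfl⟩ := Finset.mem_image.1 hm'
      rw [hext, hext]
      exact hd.strictMono_minSupp (he.strictMono_minSupp.lt_iff_lt.1 hlt)
    · rw [Finset.image_image]
      have : (Function.extend (fun i => minSupp (Finsupp.linearCombination ℝ a (d i)))
        (fun i => minSupp (d i)) 0) ∘ (fun i => minSupp (Finsupp.linearCombination ℝ a (d i))) =
        fun i => minSupp (d i) := funext hext
      rw [this]
      exact hdF
    · intro m hm
      obtain ⟨i, -, rfl⟩ := Finset.mem_image.1 hm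
      rw [hext]
      obtain ⟨l, hl, hs⟩ := exists_mem_of_mem_support_linearCombination (minSupp_mem (he.1 i))
      have hmin := minSupp_mem (hd.1 i)
      have h1 : minSupp (d i) ≤ l := minSupp_le hl
      rcases h1.lt_or_eq with h1 | h1
      · have := ha.2 _ _ h1 _ (minSupp_mem (ha.1 _)) _ hs
        exact (haM _ _ (minSupp_mem (ha.1 _))).trans this.le
      · exact haM _ _ (h1 ▸ hs)
  have key := hp _ hmem v hv1 hv2
  have hinj := he.strictMono_minSupp.injective
  rw [Finset.sum_image fun i _ j _ hij => hinj hij,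
    Finset.sum_image fun i _ j _ hij => hinj hij] at key
  simp only [hv, ← comb_block] at key
  rw [← hw] at key
  have hsum : ∑ i, comb w (d i) = comb w (∑ i, d i) := (comb_sum w _ _).symm
  rw [hsum] at key hdlt
  set V := comb w (∑ i, d i) with hV
  set S := ∑ i, ‖comb w (d i)‖ with hS
  have hS0 : 0 ≤ S := Finset.sum_nonneg fun _ _ => norm_nonneg _
  have hg0 : 0 ≤ 2 * g := (deltaConst_nonneg F w).trans (hg w hblock).le
  have hS' : 0 < S := by
    rcases hS0.lt_or_eq with h | h
    · exact h
    · rw [← h, mul_zero] at hdlt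
      exact absurd hdlt (not_lt.2 (norm_nonneg _))
  have hgpos : 0 < g := by
    by_contra hcon
    have : g = 0 := by linarith
    rw [this, mul_zero, zero_mul] at hdlt
    exact absurd hdlt (not_lt.2 (norm_nonneg _))
  have hle : S ≤ ∑ i, p (comb w (d i)) := Finset.sum_le_sum fun i _ => hp1 _
  have hpV : 0 < p V := (mul_pos ht (hS'.trans_le hle)).trans_le key
  -- The oscillation bound on `W` is transferred to the blocks; four comparisons with factors `3 /
  -- 4` and `5 / 4` produce `9` and `25`. Summing over `i` replaces the choice of a best `d i`.
  have hterm : ∀ i, 9 * (p V * ‖comb w (d i)‖) ≤ 25 * D * (p (comb w (d i)) * ‖V‖) := by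
    intro i
    obtain ⟨h1, h2, h3, h4, h5⟩ := happrox (∑ i, d i)
    obtain ⟨h1', h2', h3', h4', h5'⟩ := happrox (d i)
    have h6 := hWD _ h1 _ h1'
    have h7 : (3 / 4 * p V) * (3 / 4 * ‖comb w (d i)‖) ≤
        p (comb x (∑ i, d i)) * ‖comb x (d i)‖ :=
      mul_le_mul h4 h2' (by positivity) (apply_nonneg _ _)
    have h8 : p (comb x (d i)) * ‖comb x (∑ i, d i)‖ ≤
        (5 / 4 * p (comb w (d i))) * (5 / 4 * ‖V‖) :=
      mul_le_mul h5' h3 (norm_nonneg _) (mul_nonneg (by norm_num) (apply_nonneg _ _))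
    have h9 := mul_le_mul_of_nonneg_left h8 hD
    linarith
  have hall : 9 * (p V * S) ≤ 25 * D * ((∑ i, p (comb w (d i))) * ‖V‖) := by
    rw [hS, Finset.mul_sum, Finset.mul_sum, Finset.sum_mul, Finset.mul_sum]
    exact Finset.sum_le_sum fun i _ => hterm i
  have h10 : t * (9 * (p V * S)) ≤ 25 * D * (p V * (2 * g * S)) := by
    calc t * (9 * (p V * S)) ≤ t * (25 * D * ((∑ i, p (comb w (d i))) * ‖V‖)) :=
          mul_le_mul_of_nonneg_left hall ht.le
      _ = 25 * D * ((t * ∑ i, p (comb w (d i))) * ‖V‖) := by ring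
      _ ≤ 25 * D * (p V * (2 * g * S)) :=
          mul_le_mul_of_nonneg_left (mul_le_mul key hdlt.le (norm_nonneg _) hpV.le) (by positivity)
  have h11 : t * 9 ≤ 50 * D * g := by
    have hpos : 0 < p V * S := mul_pos hpV hS'
    refine le_of_mul_le_mul_right ?_ hpos
    linarith
  rw [div_le_iff₀ (by positivity)]
  nlinarith [mul_nonneg hD hgpos.le]

theorem deltaConst_schreierZero_pos (c : Ordinal.{0} → ℕ → Ordinal.{0}) {x : ℕ → E}
    (hx : x 0 ≠ 0) : 0 < deltaConst (schreier c 0) x := by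
  refine one_pos.trans_le (LowerEstimate.le_deltaConst ?_ hx zero_le_one ?_)
  · rw [schreier_zero]; exact Or.inr ⟨0, rfl⟩
  · rw [schreier_zero]
    rintro A (rfl | ⟨i, rfl⟩) v _ _ <;> simp

/-- `(a_{nN})^{1/N}` tends to `θ ^ n`, so eventually it exceeds `3/4 θ ^ n`. The gain `(3 / 2) ^ N`
over `(θ ^ n / 2) ^ N` absorbs any constant `R`. -/
theorem exists_pow_le {a : ℕ → ℝ} {θ : ℝ} (hθ : 0 < θ) (ha : ∀ n, n ≠ 0 → 0 < a n)
    (hlim : Tendsto (fun n : ℕ => a n ^ (1 / (n : ℝ))) atTop (𝓝 θ)) {n : ℕ} (hn : n ≠ 0)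
    (R : ℝ) : ∃ N : ℕ, N ≠ 0 ∧ R * (θ ^ n / 2) ^ N ≤ a (n * N) := by
  have hθn : 0 < θ ^ n := pow_pos hθ n
  have h1 : Tendsto (fun N : ℕ => (a (n * N) ^ (1 / ((n * N : ℕ) : ℝ))) ^ n) atTop
      (𝓝 (θ ^ n)) :=
    (hlim.comp (Filter.tendsto_id.const_mul_atTop' (Nat.pos_of_ne_zero hn))).pow n
  have h2 := h1.eventually (lt_mem_nhds (show 3 / 4 * θ ^ n < θ ^ n by linarith))
  have h3 := (tendsto_pow_atTop_atTop_of_one_lt (show (1 : ℝ) < 3 / 2 by norm_num)).eventually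
    (eventually_ge_atTop R)
  obtain ⟨N, ⟨h2, h3⟩, hN⟩ := ((h2.and h3).and (eventually_ne_atTop 0)).exists
  refine ⟨N, hN, ?_⟩
  have hnN : n * N ≠ 0 := mul_ne_zero hn hN
  have hpos := ha (n * N) hnN
  calc R * (θ ^ n / 2) ^ N ≤ (3 / 2) ^ N * (θ ^ n / 2) ^ N :=
        mul_le_mul_of_nonneg_right h3 (by positivity)
    _ = (3 / 4 * θ ^ n) ^ N := by rw [← mul_pow]; ring
    _ ≤ ((a (n * N) ^ (1 / ((n * N : ℕ) : ℝ))) ^ n) ^ N :=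
        pow_le_pow_left₀ (by positivity) h2.le N
    _ = a (n * N) := by
        rw [← pow_mul, one_div, Real.rpow_inv_natCast_pow hpos.le hnN]

theorem isArbitrarilyDistortable_of_stabilizes [CompleteSpace E]
    {c : Ordinal.{0} → ℕ → Ordinal.{0}} (hc : IsLimitChoice c) (b : SchauderBasis ℝ E)
    {γ : Ordinal.{0} → ℝ} (hstab : DeltaStabilizes c b γ) {α : Ordinal.{0}} (hα : α < ω₁)
    (hpos : 0 < γ α)
    (hlim : Tendsto (fun n : ℕ => γ (α * (n : Ordinal.{0})) * ((gammaHat γ α) ^ n)⁻¹) atTop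
      (𝓝 0)) : IsArbitrarilyDistortable E := by
  intro l hl
  obtain ⟨hγpos, hθ, hroot⟩ := hstab.exists_gammaHat hc (basis_ne_zero b) hα hpos
  set θ := gammaHat γ α with hθdef
  -- `12 = 6 · 2`: the `6` is the loss in the oscillation estimate, the `2` comes from `t = θ ^ n /
  -- 2`.
  obtain ⟨n, hn, hn0⟩ := ((hlim.eventually (gt_mem_nhds
    (show (0 : ℝ) < 1 / (12 * l) by positivity))).and (eventually_ne_atTop 0)).exists
  obtain ⟨B, hB, hBc⟩ := exists_norm_cut_le b
  -- `B * B` is the bound in `cutSum_le`; the `2` pays for having only `δ_{β·N} > γ_{β·N} / 2` on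
  -- the tail.
  obtain ⟨N, hN0, hN⟩ := exists_pow_le (a := fun n : ℕ => γ (α * n)) hθ hγpos hroot hn0
    (2 * (B * B))
  set β := α * (n : Ordinal.{0}) with hβdef
  have hmul : ∀ i : ℕ, β * i = α * (n * i : ℕ) := fun i => by
    rw [hβdef, mul_assoc, Ordinal.natCast_mul]
  have hβ : β < ω₁ := mul_nat_lt_omega_one hα n
  have hβi : ∀ i : ℕ, β * i < ω₁ := mul_nat_lt_omega_one hβ
  have hβpos : ∀ i : ℕ, i ≠ 0 → 0 < γ (β * i) := fun i hi => by
    rw [hmul]; exact hγpos _ (mul_ne_zero hn0 hi)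
  have hγβ : 0 < γ β := hγpos n hn0
  -- Only finitely many ordinals `β * i` with `i ≤ N` occur, so one tail serves them all.
  obtain ⟨K, hK1, hK2⟩ : ∃ K, (∀ i ∈ Finset.range (N + 1), i ≠ 0 →
      γ (β * i) / 2 < deltaConst (schreier c (β * i)) (tail b K)) ∧
      ∀ w : ℕ → E, IsBlockBasis w (tail b K) → deltaConst (schreier c β) w < 2 * γ β := by
    have h1 : ∀ᶠ K in atTop, ∀ i ∈ Finset.range (N + 1), i ≠ 0 →
        γ (β * i) / 2 < deltaConst (schreier c (β * i)) (tail b K) := by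
      rw [Filter.eventually_all_finset]
      intro i _
      rcases eq_or_ne i 0 with rfl | hi
      · exact Eventually.of_forall fun K h => absurd rfl h
      · have hlim := hstab.tendsto_deltaConst (hβi i) (z := fun K => tail b K) fun K =>
          isBlockBasis_refl _
        filter_upwards [hlim.eventually (lt_mem_nhds (half_lt_self (hβpos i hi)))] with K hK _
        exact hK
    obtain ⟨ε, -, hε, h⟩ := hstab
    obtain ⟨m, hm⟩ := h β hβ
    obtain ⟨K, ⟨hK1, hK2⟩, hK3⟩ := ((h1.and (hε.eventually (gt_mem_nhds hγβ))).and
      (eventually_ge_atTop m)).exists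
    refine ⟨K, hK1, fun w hw => ?_⟩
    have := (abs_lt.1 (hm K hK3 w hw)).2
    linarith
  have hδ : ∀ i ≤ N, 0 < deltaConst (schreier c (β * i)) (tail b K) := by
    intro i hi
    rcases eq_or_ne i 0 with rfl | h0
    · rw [Nat.cast_zero, mul_zero]
      exact deltaConst_schreierZero_pos c (basis_ne_zero b _)
    · exact (half_pos (hβpos i h0)).trans (hK1 i (Finset.mem_range.2 (by omega)) h0)
  have hstep : ∀ i : ℕ, β * i + β = β * (i + 1 : ℕ) := fun i => by
    rw [Nat.cast_add, Nat.cast_one, mul_add, mul_one]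
  choose M _ hM using fun i : ℕ => exists_familyComp_sparseFamily_subset hc (α := β) (β := β * i)
    (by rw [hstep]; exact hβi _)
  set M' : ℕ → ℕ := fun j => ∑ i ∈ Finset.range N, M i j with hM'
  have hsub : ∀ i < N, familyComp (sparseFamily M' (schreier c β)) (schreier c (β * i)) ⊆
      schreier c (β * (i + 1 : ℕ)) := by
    intro i hi
    refine (familyComp_mono (sparseFamily_anti (fun j => ?_) _) subset_rfl).trans
      ((hM i).trans (hstep i ▸ subset_rfl))
    exact Finset.single_le_sum (f := fun i => M i j) (fun _ _ => Nat.zero_le _)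
      (Finset.mem_range.2 hi)
  have htpos : 0 < θ ^ n / 2 := by positivity
  obtain ⟨p, C, hp1, hpC, hp⟩ := exists_seminorm_of_chain hB (hBc K) hN0
    (F := fun i => schreier c (β * i)) (H := sparseFamily M' (schreier c β))
    (fun i => isSpreading_schreier c _) ((isSpreading_schreier c β).sparseFamily M')
    (singleton_mem_schreier hc (hβi 0) 0) (fun i => empty_mem_schreier hc (hβi i)) hsub hδ
    (fun i _ => lowerEstimate_deltaConst (isSpreading_schreier c _) _) ⟨θ ^ n / 2, htpos.le⟩ (by
      have h1 := hK1 N (Finset.mem_range.2 (by omega)) hN0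
      have h2 := hδ N le_rfl
      rw [mul_div_assoc', div_le_one h2]
      rw [hmul] at h1 h2 ⊢
      change (θ ^ n / 2) ^ N * (B * B) ≤ _
      linarith)
  refine ⟨p, ⟨1, C, one_pos, fun x => ⟨by rw [one_mul]; exact hp1 x, hpC x⟩⟩, ?_⟩
  have htop : ¬ FiniteDimensional ℝ (⊤ : Submodule ℝ E) := by
    intro h
    have : FiniteDimensional ℝ E := Module.Finite.equiv Submodule.topEquiv
    have hli := GeneralSchauderBasis.linearIndependent b
    have := hli.finite
    exact not_finite ℕ
  have : Nonempty (InfSubspace E) := ⟨⟨⊤, isClosed_univ, htop⟩⟩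
  refine le_ciInf fun W => ?_
  set D := sSup {r : ℝ | ∃ x ∈ W.1, ∃ y ∈ W.1, ‖x‖ = 1 ∧ ‖y‖ = 1 ∧ r = p x / p y} with hD
  have hbdd : BddAbove {r : ℝ | ∃ x ∈ W.1, ∃ y ∈ W.1, ‖x‖ = 1 ∧ ‖y‖ = 1 ∧ r = p x / p y} := by
    refine ⟨C, ?_⟩
    rintro _ ⟨x, -, y, -, hx, hy, rfl⟩
    have h1 := hp1 y
    have h2 := hpC x
    rw [hy] at h1
    rw [hx, mul_one] at h2
    exact (div_le_self (apply_nonneg _ _) h1).trans h2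
  have hD0 : 0 ≤ D := by
    refine Real.sSup_nonneg ?_
    rintro _ ⟨x, -, y, -, -, -, rfl⟩
    exact div_nonneg (apply_nonneg _ _) (apply_nonneg _ _)
  have hWD : ∀ x ∈ W.1, ∀ y ∈ W.1, p x * ‖y‖ ≤ D * (p y * ‖x‖) := by
    intro x hx y hy
    rcases eq_or_ne x 0 with rfl | hx0
    · simp
    rcases eq_or_ne y 0 with rfl | hy0
    · simp
    have hxn : 0 < ‖x‖ := norm_pos_iff.2 hx0
    have hyn : 0 < ‖y‖ := norm_pos_iff.2 hy0
    have hpy : 0 < p y := hyn.trans_le (hp1 y)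
    have h := le_csSup hbdd ⟨‖x‖⁻¹ • x, W.1.smul_mem _ hx, ‖y‖⁻¹ • y, W.1.smul_mem _ hy,
      by rw [norm_smul, norm_inv, norm_norm, inv_mul_cancel₀ hxn.ne'],
      by rw [norm_smul, norm_inv, norm_norm, inv_mul_cancel₀ hyn.ne'], rfl⟩
    rw [← hD, map_smul_eq_mul, map_smul_eq_mul, norm_inv, norm_inv, norm_norm, norm_norm,
      div_le_iff₀ (by positivity)] at h
    calc p x * ‖y‖ = (‖x‖⁻¹ * p x) * (‖x‖ * ‖y‖) := by field_simp
      _ ≤ (D * (‖y‖⁻¹ * p y)) * (‖x‖ * ‖y‖) := mul_le_mul_of_nonneg_right h (by positivity)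
      _ = D * (p y * ‖x‖) := by field_simp
  have hfin := le_of_oscillation_le hB (hBc K) (singleton_mem_schreier hc hβ 0) hK2 htpos hp1 hpC
    hp W.2.2 hD0 hWD
  refine le_trans ?_ hfin
  rw [le_div_iff₀ (by positivity)]
  have h1 : γ β < 1 / (12 * l) * θ ^ n := by
    rwa [← div_eq_mul_inv, div_lt_iff₀ (pow_pos hθ n)] at hn
  have h2 : l * (6 * (1 / (12 * l) * θ ^ n)) = θ ^ n / 2 := by
    field_simp
    norm_num
  have h3 : l * (6 * γ β) ≤ l * (6 * (1 / (12 * l) * θ ^ n)) := by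
    have : 0 < l := one_pos.trans hl
    gcongr
  linarith

end Distortion

/-! ### The closed span of a block basis -/

section BlockSubspace

variable {X : Type*} [NormedAddCommGroup X] [NormedSpace ℝ X]

theorem coord_comb (e : SchauderBasis ℝ X) (a : ℕ →₀ ℝ) (i : ℕ) : e.coord i (comb e a) = a i := by
  classical
  rw [comb, Finsupp.linearCombination_apply, Finsupp.sum, map_sum]
  simp only [map_smul, e.ortho, Pi.single_apply, smul_eq_mul, mul_ite, mul_one, mul_zero]
  rw [Finset.sum_ite_eq]
  split_ifs with h
  · rfl
  · exact (Finsupp.notMem_support_iff.1 h).symm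

/-- A block basis of a Schauder basis is a Schauder basis of its closed linear span. -/
theorem exists_schauderBasis_closedSpan (e : SchauderBasis ℝ X) {y : ℕ → X}
    (hy : IsBlockBasis y e) :
    ∃ b : SchauderBasis ℝ (closedSpan y), ∀ i, (b i : X) = y i := by
  classical
  obtain ⟨a, ha, hya⟩ := hy
  let s : ℕ → ℕ := fun j => minSupp (a j)
  have hs : StrictMono s := ha.strictMono_minSupp
  have has : ∀ j, a j (s j) ≠ 0 := fun j => Finsupp.mem_support_iff.1 (minSupp_mem (ha.1 j))
  have hys : ∀ j, y j ∈ closedSpan y := fun j =>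
    Submodule.le_topologicalClosure _ (Submodule.subset_span ⟨j, rfl⟩)
  -- The `e`-coordinate at the first support point of `a j`, normalized; it is biorthogonal because
  -- the supports are disjoint.
  let φ : ℕ → X →L[ℝ] ℝ := fun j => (a j (s j))⁻¹ • e.coord (s j)
  have hφ : ∀ i j, φ i (y j) = if i = j then 1 else 0 := by
    intro i j
    simp only [φ, smul_apply, smul_eq_mul]
    rw [hya, coord_comb]
    split_ifs with h
    · rw [h, inv_mul_cancel₀ (has j)]
    · have : a j (s i) = 0 := by
        by_contra h0
        have h0 := Finsupp.mem_support_iff.2 h0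
        rcases lt_or_gt_of_ne h with h | h
        · exact lt_irrefl _ ((hs h).trans_le (minSupp_le h0))
        · exact lt_irrefl _ (ha.2 j i h _ h0 _ (minSupp_mem (ha.1 i)))
      rw [this, mul_zero]
  have hproj : ∀ n j, SchauderBasis.proj e (s n) (y j) = if j < n then y j else 0 := by
    intro n j
    rw [hya, comb, Finsupp.linearCombination_apply, Finsupp.sum, map_sum]
    simp only [map_smul, SchauderBasis.proj_apply_basis_mem]
    split_ifs with h
    · refine Finset.sum_congr rfl fun i hi => ?_
      rw [if_pos (ha.2 j n h i hi _ (minSupp_mem (ha.1 n)))]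
    · refine Finset.sum_eq_zero fun i hi => ?_
      have := hs.monotone (not_lt.1 h)
      have := minSupp_le hi
      rw [if_neg (by simp only [s] at *; omega), smul_zero]
  -- On the closed span, the `n`-th partial sum along `y` is a partial sum projection of `e`, by
  -- density. Convergence is therefore inherited from `e` along the subsequence `s`.
  have hexp : ∀ n, ∀ x ∈ closedSpan y,
      ∑ i ∈ Finset.range n, φ i x • y i = SchauderBasis.proj e (s n) x := by
    intro n
    let T : X →L[ℝ] X := ∑ i ∈ Finset.range n, (φ i).smulRight (y i)
    have hT : ∀ x, T x = ∑ i ∈ Finset.range n, φ i x • y i := fun x => by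
      simp only [T, _root_.sum_apply, ContinuousLinearMap.smulRight_apply]
    have hEq : Set.EqOn T (SchauderBasis.proj e (s n))
        (closure (Submodule.span ℝ (Set.range y))) := by
      refine Set.EqOn.closure ?_ T.continuous (SchauderBasis.proj e (s n)).continuous
      refine LinearMap.eqOn_span (f := T.toLinearMap)
        (g := (SchauderBasis.proj e (s n)).toLinearMap) ?_
      rintro _ ⟨j, rfl⟩
      change T (y j) = SchauderBasis.proj e (s n) (y j)
      rw [hT, hproj]
      simp only [hφ, ite_smul, one_smul, zero_smul, Finset.sum_ite_eq', Finset.mem_range]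
    intro x hx
    rw [← hT]
    exact hEq hx
  refine ⟨{ basis := fun i => ⟨y i, hys i⟩
            coord := fun i => (φ i).comp (closedSpan y).subtypeL
            ortho := fun i j => ?_
            expansion := fun x => ?_ }, fun i => rfl⟩
  · refine (hφ i j).trans ?_
    split_ifs with h <;> simp [h]
  · rw [HasSum, SummationFilter.conditional_filter_eq_map_range, tendsto_map'_iff,
      tendsto_subtype_rng]
    refine ((SchauderBasis.tendsto_proj e (x : X)).comp hs.tendsto_atTop).congr fun n => ?_
    rw [Function.comp, ← hexp n x x.2]
    simp

theorem coe_comb {Y : Submodule ℝ X} (y : ℕ → Y) (a : ℕ →₀ ℝ) :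
    ((comb y a : Y) : X) = comb (fun i => (y i : X)) a := by
  simp only [comb, Finsupp.linearCombination_apply, Finsupp.sum, Submodule.coe_sum,
    Submodule.coe_smul]

theorem deltaConst_coe {Y : Submodule ℝ X} (F : Set (Finset ℕ)) (y : ℕ → Y) :
    deltaConst F (fun i => (y i : X)) = deltaConst F y := by
  simp only [deltaConst, ← coe_comb, ← Submodule.coe_sum, Submodule.coe_norm]

theorem DeltaStabilizes.of_coe {Y : Submodule ℝ X} {c : Ordinal.{0} → ℕ → Ordinal.{0}}
    {y : ℕ → Y} {γ : Ordinal.{0} → ℝ} (h : DeltaStabilizes c (fun i => (y i : X)) γ) :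
    DeltaStabilizes c y γ := by
  obtain ⟨ε, hε, hε0, h⟩ := h
  refine ⟨ε, hε, hε0, fun α hα => ?_⟩
  obtain ⟨m, hm⟩ := h α hα
  refine ⟨m, fun n hn z hz => ?_⟩
  rw [← deltaConst_coe]
  refine hm n hn _ ?_
  obtain ⟨a, ha, hz⟩ := hz
  exact ⟨a, ha, fun j => (congrArg Subtype.val (hz j)).trans (coe_comb _ _)⟩

end BlockSubspace

end DeltaSpectrum

end

theorem corollary6p9 {X : Type*} [NormedAddCommGroup X] [NormedSpace ℝ X] [CompleteSpace X]
    (c : Ordinal.{0} → ℕ → Ordinal.{0}) (hc : IsLimitChoice c)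
    (e : SchauderBasis ℝ X) (hX : IsAsymptoticL1 e)
    (γ : Ordinal.{0} → ℝ) (hγ : γ ∈ deltaSpectrum c e)
    (y : ℕ → X) (hy : IsBlockBasis y e) (hstab : DeltaStabilizes c y γ)
    (h : ∃ α : Ordinal.{0}, α < ω₁ ∧ 0 < γ α ∧
      Tendsto (fun n : ℕ => γ (α * (n : Ordinal.{0})) * ((gammaHat γ α) ^ n)⁻¹) atTop (𝓝 0)) :
    ∃ Z : Submodule ℝ X, Z ≤ closedSpan y ∧ IsClosed (Z : Set X) ∧ ¬ FiniteDimensional ℝ Z ∧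
      IsArbitrarilyDistortable Z := by
  obtain ⟨α, hα, hpos, hlim⟩ := h
  obtain ⟨b, hb⟩ := exists_schauderBasis_closedSpan e hy
  have hclosed : IsClosed (closedSpan y : Set X) := Submodule.isClosed_topologicalClosure _
  have : CompleteSpace (closedSpan y) := hclosed.completeSpace_coe
  have hstab' : DeltaStabilizes c b γ := by
    refine DeltaStabilizes.of_coe ?_
    rwa [show (fun i => (b i : X)) = y from funext hb]
  refine ⟨closedSpan y, le_rfl, hclosed, fun hfin => ?_,
    isArbitrarilyDistortable_of_stabilizes hc b hstab' hα hpos hlim⟩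
  have := (GeneralSchauderBasis.linearIndependent b).finite
  exact not_finite ℕ
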